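/- Let $n\ge 1$, let $\Omega\subset\mathbb R^n$ be a bounded open set, $\Omega_e=\mathbb R^n\setminus\overline\Omega$, let $W$ be an open set with $W\Subset\Omega_e$ (that is, $\overline W$ is compact and contained in $\Omega_e$), let $x_0\in W$, $0<s<1$ and $1<p<\infty$. Write $$[u]_{W^{t,p}}=\Big(\int_{\mathbb R^{2n}}\frac{|u(x)-u(y)|^p}{|x-y|^{n+tp}}\,dx\,dy\Big)^{1/p},\qquad \|u\|_{W^{t,p}}=\big(\|u\|_{L^p}^p+[u]_{W^{t,p}}^p\big)^{1/p}\quad(0<t<1),\qquad \|u\|_{W^{0,p}}=\|u\|_{L^p},$$ let $W^{s,p}(\mathbb R^n)$ be the space of $u\in L^p(\mathbb R^n)$ with $[u]_{W^{s,p}}<\infty$, and let $\widetilde W^{s,p}(\Omega)$ be the closure of $C_c^\infty(\Omega)$ in $W^{s,p}(\mathbb R^n)$. For a measurable $\sigma\colon\mathbb R^n\times\mathbb R^n\to\mathbb R$ put $$B_\sigma(u,\varphi)=\int_{\mathbb R^{2n}}\sigma(x,y)\,|u(x)-u(y)|^{p-2}\,\frac{(u(x)-u(y))(\varphi(x)-\varphi(y))}{|x-y|^{n+sp}}\,dx\,dy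 .$$ For $f\in W^{s,p}(\mathbb R^n)$, a weak solution with exterior value $f$ is a function $u\in W^{s,p}(\mathbb R^n)$ with $u-f\in\widetilde W^{s,p}(\Omega)$ and $B_\sigma(u,\varphi)=0$ for all $\varphi\in C_c^\infty(\Omega)$. Then there is a sequence $(\Phi_N)_{N\in\mathbb N}\subset C_c^\infty(W)$ such that 1. $[\Phi_N]_{W^{s,p}}=1$ for all $N$; 2. $\|\Phi_N\|_{W^{t,p}}\to0$ as $N\to\infty$ for every $0\le t<s$; 3. $\operatorname{supp}\Phi_N\to\{x_0\}$, i.e. every neighbourhood of $x_0$ contains $\operatorname{supp}\Phi_N$ for all sufficiently large $N$; and such that the following holds for every measurable $\sigma\colon\mathbb R^n\times\mathbb R^n\to\mathbb R$ for which there is $\lambda>0$ with $\lambda\le\sigma(x,y)\le\lambda^{-1}$ for all $x,y\in\mathbb R^n$, the family $(\sigma(x,\cdot)\colon W\to\mathbb R)_{x\in\mathbb R^n}$ is equicontinuous at $x_0$, and $\sigma(\cdot,x_0)$ is continuous on $W$: for every $f\in W^{s,p}(\mathbb R^n)$ there is a weak solution $u_f$ with exterior value $f$, unique up to null sets, and the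 Dirichlet-to-Neumann map $\langle\Lambda_\sigma f,g\rangle=B_\sigma(u_f,g)$ satisfies $$\sigma(x_0,x_0)=\lim_{N\to\infty}\langle\Lambda_\sigma\Phi_N,\Phi_N\rangle .$$ -/

import Mathlib

open MeasureTheory Filter Topology
open scoped ENNReal

noncomputable section

/-- The exterior domain `Ω_e = ℝⁿ \ closure Ω`. -/
def exteriorDomain {n : ℕ} (Ω : Set (EuclideanSpace ℝ (Fin n))) :
    Set (EuclideanSpace ℝ (Fin n)) :=
  (closure Ω)ᶜ

/-- `V ⋐ U`: the set `V` is compactly contained in `U`. -/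
def CompactlyContained {n : ℕ} (V U : Set (EuclideanSpace ℝ (Fin n))) : Prop :=
  IsCompact (closure V) ∧ closure V ⊆ U

/-- `φ ∈ C_c^∞(U)`, extended by zero to all of `ℝⁿ`. -/
def IsTestFunction {n : ℕ} (U : Set (EuclideanSpace ℝ (Fin n)))
    (φ : EuclideanSpace ℝ (Fin n) → ℝ) : Prop :=
  ContDiff ℝ (⊤ : ℕ∞) φ ∧ HasCompactSupport φ ∧ tsupport φ ⊆ U

/-- The Gagliardo seminorm
`[u]_{W^{s,p}(ℝⁿ)} = (∫∫ |u(x) - u(y)|^p / |x - y|^(n + s p) dx dy)^(1/p)`,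
with values in `[0, ∞]`. -/
def gagliardoSeminorm {n : ℕ} (s p : ℝ) (u : EuclideanSpace ℝ (Fin n) → ℝ) : ℝ≥0∞ :=
  (∫⁻ z : EuclideanSpace ℝ (Fin n) × EuclideanSpace ℝ (Fin n),
    ENNReal.ofReal (|u z.1 - u z.2| ^ p / ‖z.1 - z.2‖ ^ ((n : ℝ) + s * p))) ^ (1 / p)

/-- The norm of `W^{s,p}(ℝⁿ)` for `0 ≤ s < 1`, with values in `[0, ∞]`: for `s = 0` it is the
`L^p` norm, and for `0 < s < 1` it is `(‖u‖_{L^p}^p + [u]_{W^{s,p}}^p)^(1/p)`. -/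
def sobolevNorm {n : ℕ} (s p : ℝ) (u : EuclideanSpace ℝ (Fin n) → ℝ) : ℝ≥0∞ :=
  if s = 0 then eLpNorm u (ENNReal.ofReal p) volume
  else (eLpNorm u (ENNReal.ofReal p) volume ^ p + gagliardoSeminorm s p u ^ p) ^ (1 / p)

/-- `u ∈ W^{s,p}(ℝⁿ)`, for `0 < s < 1` (elements are represented by functions). -/
def MemSobolev {n : ℕ} (s p : ℝ) (u : EuclideanSpace ℝ (Fin n) → ℝ) : Prop :=
  MemLp u (ENNReal.ofReal p) volume ∧ gagliardoSeminorm s p u < ⊤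

/-- `u ∈ W̃^{s,p}(Ω)`, the closure of `C_c^∞(Ω)` in `W^{s,p}(ℝⁿ)`. -/
def MemSobolevTilde {n : ℕ} (s p : ℝ) (Ω : Set (EuclideanSpace ℝ (Fin n)))
    (u : EuclideanSpace ℝ (Fin n) → ℝ) : Prop :=
  MemSobolev s p u ∧
    ∀ ε : ℝ≥0∞, 0 < ε → ∃ φ, IsTestFunction Ω φ ∧ sobolevNorm s p (u - φ) < ε

/-- Uniform ellipticity: `l ≤ σ ≤ l⁻¹` everywhere, for some constant `l > 0`. -/
def UniformlyElliptic {n : ℕ}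
    (σ : EuclideanSpace ℝ (Fin n) → EuclideanSpace ℝ (Fin n) → ℝ) : Prop :=
  ∃ l : ℝ, 0 < l ∧ ∀ x y, l ≤ σ x y ∧ σ x y ≤ l⁻¹

/-- The weighted fractional `p`-Laplacian of `u` tested against `φ`:
`∫∫ σ(x,y) |u(x)-u(y)|^(p-2) (u(x)-u(y)) (φ(x)-φ(y)) / |x-y|^(n+sp) dx dy`. -/
def weightedPLaplacian {n : ℕ} (s p : ℝ)
    (σ : EuclideanSpace ℝ (Fin n) → EuclideanSpace ℝ (Fin n) → ℝ)
    (u φ : EuclideanSpace ℝ (Fin n) → ℝ) : ℝ :=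
  ∫ z : EuclideanSpace ℝ (Fin n) × EuclideanSpace ℝ (Fin n),
    σ z.1 z.2 * |u z.1 - u z.2| ^ (p - 2) * (u z.1 - u z.2) * (φ z.1 - φ z.2)
      / ‖z.1 - z.2‖ ^ ((n : ℝ) + s * p)

/-- `u` is a weak solution of the weighted fractional `p`-Laplace equation in `Ω` with exterior
value `f`: `u ∈ W^{s,p}(ℝⁿ)`, the equation holds in the sense of distributions in `Ω`, and
`u - f ∈ W̃^{s,p}(Ω)`. -/
def IsWeakSolution {n : ℕ} (Ω : Set (EuclideanSpace ℝ (Fin n))) (s p : ℝ)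
    (σ : EuclideanSpace ℝ (Fin n) → EuclideanSpace ℝ (Fin n) → ℝ)
    (f u : EuclideanSpace ℝ (Fin n) → ℝ) : Prop :=
  MemSobolev s p u ∧
    (∀ φ, IsTestFunction Ω φ → weightedPLaplacian s p σ u φ = 0) ∧
    MemSobolevTilde s p Ω (u - f)

/-- The weak solution `u_f` with exterior value `f` (it is unique up to null sets; a representative
is chosen). -/
def weakSolution {n : ℕ} (Ω : Set (EuclideanSpace ℝ (Fin n))) (s p : ℝ)
    (σ : EuclideanSpace ℝ (Fin n) → EuclideanSpace ℝ (Fin n) → ℝ)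
    (f : EuclideanSpace ℝ (Fin n) → ℝ) : EuclideanSpace ℝ (Fin n) → ℝ :=
  Classical.epsilon (IsWeakSolution Ω s p σ f)

/-- The Dirichlet-to-Neumann map: `⟨Λ_σ f, g⟩` is the weighted fractional `p`-Laplacian of the
solution `u_f` tested against `g`. -/
def dnMap {n : ℕ} (Ω : Set (EuclideanSpace ℝ (Fin n))) (s p : ℝ)
    (σ : EuclideanSpace ℝ (Fin n) → EuclideanSpace ℝ (Fin n) → ℝ)
    (f g : EuclideanSpace ℝ (Fin n) → ℝ) : ℝ :=
  weightedPLaplacian s p σ (weakSolution Ω s p σ f) g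

end

/-! Write $du(x,y)=u(x)-u(y)$ and $E_\sigma(u)=\int|du|^p\,\sigma(x,y)|x-y|^{-n-sp}\,dx\,dy$. Then
$B_\sigma(u,\varphi)$ is, up to the factor $p$, the derivative of $E_\sigma$ at $u$ in the direction
$\varphi$, so the exterior value problem asks for the minimiser of an $L^p$ norm over a translate of
a closed subspace. Convexity in quantitative form (`exists_abs_sub_rpow_le`) makes minimising
sequences Cauchy, and a fractional Poincaré inequality (`exists_poincare`) recovers functions from
their differences. Strict monotonicity of $a\mapsto|a|^{p-2}a$ gives uniqueness. Testing the
equation with $u_f-f$ yields $\langle\Lambda_\sigma f,f\rangle=E_\sigma(u_f)$, and Young's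
inequality then yields $E_\sigma(u_f)\le E_\sigma(f)$.

The $\Phi_N$ are bumps of unit seminorm in balls of radius $R_N\to0$ about $x_0$. By Poincaré,
$\|\Phi_N\|_{L^p}^p\le CR_N^{sp}\to0$. The energy at distance at least $\delta$ from the diagonal is
at most $C_\delta\|\Phi_N\|_{L^p}^p$ (`exists_lintegral_far_le`), so all the energy concentrates
near $(x_0,x_0)$. This gives the decay of the lower order norms, and
$E_\sigma(\Phi_N)\to\sigma(x_0,x_0)$ because $\sigma$ is nearly constant there.

It remains to compare $E_\sigma(u_N)$ with $E_\sigma(\Phi_N)$, where $u_N$ is the solution with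
exterior value $\Phi_N$. Minimality is the upper bound. For the lower bound, $u_N=\Phi_N$ off
$\Omega$, in particular around $x_0$, so $u_N$ carries all of the near-diagonal energy of $\Phi_N$,
and only the vanishing far part can be lost. No estimate of $u_N-\Phi_N$ is needed. -/

open MeasureTheory Filter Topology
open scoped ENNReal

noncomputable section

/-! ### Scalar inequalities for $|a|^p$ and its derivative -/

/-- The odd power `|a|^(p-2) a`, the derivative of `|a|^p / p`. -/
def signedPow (p a : ℝ) : ℝ := |a| ^ (p - 2) * a

theorem measurable_signedPow (p : ℝ) : Measurable (signedPow p) := by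
  unfold signedPow
  fun_prop

theorem signedPow_mul_self {p : ℝ} (hp : 1 < p) (a : ℝ) : signedPow p a * a = |a| ^ p := by
  rcases eq_or_ne a 0 with rfl | ha
  · simp [signedPow, Real.zero_rpow (by linarith : p ≠ 0)]
  · have h : 0 < |a| := abs_pos.2 ha
    rw [signedPow, mul_assoc, ← sq, ← sq_abs, ← Real.rpow_natCast, ← Real.rpow_add h]
    norm_num

theorem abs_signedPow {p : ℝ} (hp : 1 < p) (a : ℝ) : |signedPow p a| = |a| ^ (p - 1) := by
  rcases eq_or_ne a 0 with rfl | ha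
  · simp [signedPow, Real.zero_rpow (by linarith : p - 1 ≠ 0)]
  · have h : 0 < |a| := abs_pos.2 ha
    rw [signedPow, abs_mul, abs_of_nonneg (Real.rpow_nonneg h.le _)]
    nth_rewrite 2 [← Real.rpow_one |a|]
    rw [← Real.rpow_add h]
    ring_nf

theorem strictMono_signedPow {p : ℝ} (hp : 1 < p) : StrictMono (signedPow p) := by
  refine strictMono_of_odd_strictMonoOn_nonneg (fun x => by simp [signedPow]) ?_
  have key : ∀ x : ℝ, 0 ≤ x → signedPow p x = x ^ (p - 1) := fun x hx => by
    have h := abs_signedPow hp x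
    rwa [abs_of_nonneg hx, abs_of_nonneg] at h
    exact mul_nonneg (by positivity) hx
  intro x hx y hy hxy
  rw [key x hx, key y hy]
  exact Real.rpow_lt_rpow hx hxy (by linarith)

theorem signedPow_sub_mul_sub_nonneg {p : ℝ} (hp : 1 < p) (a b : ℝ) :
    0 ≤ (signedPow p a - signedPow p b) * (a - b) := by
  rcases le_total a b with h | h
  · exact mul_nonneg_of_nonpos_of_nonpos
      (sub_nonpos.2 ((strictMono_signedPow hp).monotone h)) (sub_nonpos.2 h)
  · exact mul_nonneg (sub_nonneg.2 ((strictMono_signedPow hp).monotone h)) (sub_nonneg.2 h)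

theorem eq_of_signedPow_sub_mul_sub_eq_zero {p : ℝ} (hp : 1 < p) {a b : ℝ}
    (h : (signedPow p a - signedPow p b) * (a - b) = 0) : a = b := by
  rcases mul_eq_zero.1 h with h | h
  · exact (strictMono_signedPow hp).injective (sub_eq_zero.1 h)
  · exact sub_eq_zero.1 h

/-- Young's inequality for the product of an odd power and a number. -/
theorem abs_signedPow_mul_le {p : ℝ} (hp : 1 < p) (a b : ℝ) :
    |signedPow p a * b| ≤ (1 - 1 / p) * |a| ^ p + 1 / p * |b| ^ p := by
  have hp0 : p - 1 ≠ 0 := by linarith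
  have h := Real.young_inequality_of_nonneg (abs_nonneg b)
    (Real.rpow_nonneg (abs_nonneg a) (p - 1)) (Real.HolderConjugate.conjExponent hp)
  rw [← Real.rpow_mul (abs_nonneg a), Real.conjExponent,
    show (p - 1) * (p / (p - 1)) = p by field_simp] at h
  rw [abs_mul, abs_signedPow hp, mul_comm]
  refine h.trans (le_of_eq ?_)
  field_simp
  ring

theorem abs_signedPow_mul_le_add {p : ℝ} (hp : 1 < p) (a b : ℝ) :
    |signedPow p a * b| ≤ |a| ^ p + |b| ^ p := by
  refine (abs_signedPow_mul_le hp a b).trans ?_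
  have ha : 0 ≤ |a| ^ p := by positivity
  have hb : 0 ≤ |b| ^ p := by positivity
  have h1 : 1 / p ≤ 1 := by rw [div_le_one (by linarith)]; exact hp.le
  have h0 : 0 ≤ 1 / p := by positivity
  nlinarith

/-- If $|a|\ne|b|$, strict convexity of $t^p$ on $[0,\infty)$ applies to the absolute values.
Otherwise $a=-b\ne0$ and the midpoint is zero. -/
theorem abs_midpoint_rpow_lt {p : ℝ} (hp : 1 < p) {a b : ℝ} (hab : a ≠ b) :
    |(a + b) / 2| ^ p < (|a| ^ p + |b| ^ p) / 2 := by
  have hp0 : 0 < p := by linarith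
  by_cases h : |a| = |b|
  · rcases abs_eq_abs.1 h with h' | h'
    · exact absurd h' hab
    · have hb : b ≠ 0 := by rintro rfl; simp at h'; exact hab h'
      have : 0 < |b| ^ p := Real.rpow_pos_of_pos (abs_pos.2 hb) _
      subst h'
      simp [Real.zero_rpow hp0.ne']
      linarith
  · have h1 := (strictConvexOn_rpow hp).2 (abs_nonneg a) (abs_nonneg b) h
      (by norm_num : (0 : ℝ) < 1 / 2) (by norm_num : (0 : ℝ) < 1 / 2) (by norm_num)
    simp only [smul_eq_mul] at h1
    refine lt_of_le_of_lt (Real.rpow_le_rpow (abs_nonneg _) ?_ hp0.le) (h1.trans_eq (by ring))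
    rw [abs_div, abs_two]
    linarith [abs_add_le a b]

theorem abs_midpoint_rpow_le {p : ℝ} (hp : 1 < p) (a b : ℝ) :
    |(a + b) / 2| ^ p ≤ (|a| ^ p + |b| ^ p) / 2 := by
  rcases eq_or_ne a b with rfl | h
  · simp
  · exact (abs_midpoint_rpow_lt hp h).le

/-- A quantitative form of the strict convexity of `|a|^p`. -/
theorem exists_abs_sub_rpow_le {p : ℝ} (hp : 1 < p) {ε : ℝ} (hε : 0 < ε) :
    ∃ C : ℝ, 0 ≤ C ∧ ∀ a b : ℝ, |a - b| ^ p ≤ ε * (|a| ^ p + |b| ^ p) +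
      C * ((|a| ^ p + |b| ^ p) / 2 - |(a + b) / 2| ^ p) := by
  have hp0 : 0 < p := by linarith
  have hc : ∀ f : ℝ × ℝ → ℝ, Continuous f → Continuous fun z => |f z| ^ p := fun f hf =>
    hf.abs.rpow_const fun _ => Or.inr hp0.le
  have c1 := hc Prod.fst continuous_fst
  have c2 := hc Prod.snd continuous_snd
  have c3 := hc (fun z => z.1 - z.2) (by fun_prop)
  have c4 := hc (fun z => (z.1 + z.2) / 2) (by fun_prop)
  -- `K` is the part of the unit sphere where the `ε` term alone may not suffice. It avoids the line
  -- $a=b$, so the convexity gap is positive on it, and `C` comes from compactness.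
  set K : Set (ℝ × ℝ) := Metric.sphere 0 1 ∩
    {z | ε * (|z.1| ^ p + |z.2| ^ p) ≤ |z.1 - z.2| ^ p} with hK
  have hKc : IsCompact K := (isCompact_sphere 0 1).inter_right
    (isClosed_le (by fun_prop) (by fun_prop))
  have hpos : ∀ z ∈ K, 0 < (|z.1| ^ p + |z.2| ^ p) / 2 - |(z.1 + z.2) / 2| ^ p := by
    rintro ⟨a, b⟩ ⟨hz1, hz2⟩
    refine sub_pos.2 (abs_midpoint_rpow_lt hp ?_)
    intro hab
    obtain rfl : a = b := hab
    simp only [Set.mem_ofPred_eq, sub_self, abs_zero, Real.zero_rpow hp0.ne'] at hz2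
    have ha : |a| = 1 := by simpa [Prod.norm_def] using hz1
    rw [ha] at hz2
    norm_num at hz2
    linarith
  obtain ⟨C, hC⟩ := hKc.exists_bound_of_continuousOn (f := fun z : ℝ × ℝ =>
    |z.1 - z.2| ^ p / ((|z.1| ^ p + |z.2| ^ p) / 2 - |(z.1 + z.2) / 2| ^ p))
    (ContinuousOn.div c3.continuousOn (by fun_prop) fun z hz => (hpos z hz).ne')
  refine ⟨max C 0, le_max_right _ _, ?_⟩
  have hunit : ∀ z ∈ Metric.sphere (0 : ℝ × ℝ) 1, |z.1 - z.2| ^ p ≤ ε * (|z.1| ^ p + |z.2| ^ p) +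
      max C 0 * ((|z.1| ^ p + |z.2| ^ p) / 2 - |(z.1 + z.2) / 2| ^ p) := by
    intro z hz
    have hG := sub_nonneg.2 (abs_midpoint_rpow_le hp z.1 z.2)
    have hS : 0 ≤ |z.1| ^ p + |z.2| ^ p := by positivity
    by_cases hzK : z ∈ K
    · have h1 := (le_abs_self _).trans (hC z hzK)
      rw [div_le_iff₀ (hpos z hzK)] at h1
      have h2 := mul_le_mul_of_nonneg_right (le_max_left C 0) hG
      have h3 := mul_nonneg hε.le hS
      linarith
    · have h1 : |z.1 - z.2| ^ p ≤ ε * (|z.1| ^ p + |z.2| ^ p) := by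
        by_contra h
        exact hzK ⟨hz, (not_le.1 h).le⟩
      have h2 := mul_nonneg (le_max_right C 0) hG
      linarith
  intro a b
  -- Every term is homogeneous of degree $p$, so the bound on the unit sphere extends by scaling.
  set M := ‖(a, b)‖ with hM
  rcases eq_or_ne M 0 with h0 | h0
  · have : (a, b) = 0 := norm_eq_zero.1 h0
    obtain ⟨rfl, rfl⟩ := Prod.mk_eq_zero.1 this
    simp [Real.zero_rpow hp0.ne']
  · have hM0 : 0 < M := lt_of_le_of_ne (norm_nonneg _) h0.symm
    have h := hunit (M⁻¹ • (a, b)) (by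
      rw [mem_sphere_zero_iff_norm, norm_smul, norm_inv, norm_norm, inv_mul_cancel₀ h0])
    have hs : ∀ x : ℝ, |M⁻¹ * x| ^ p = (M ^ p)⁻¹ * |x| ^ p := fun x => by
      rw [abs_mul, abs_of_pos (inv_pos.2 hM0), Real.mul_rpow (by positivity) (abs_nonneg _),
        Real.inv_rpow hM0.le]
    simp only [Prod.smul_mk, smul_eq_mul] at h
    rw [← mul_sub, ← mul_add, mul_div_assoc, hs, hs, hs, hs] at h
    have hMp : 0 < M ^ p := Real.rpow_pos_of_pos hM0 _
    have h' := mul_le_mul_of_nonneg_left h hMp.le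
    calc |a - b| ^ p = M ^ p * ((M ^ p)⁻¹ * |a - b| ^ p) := by field_simp
      _ ≤ _ := h'
      _ = _ := by field_simp

/-! ### Convexity and energy minimisation in $L^p$ -/

section Integral

variable {X : Type*} [MeasurableSpace X] {m : Measure X} {p : ℝ}

theorem integrable_abs_rpow (hp : 1 < p) {f : X → ℝ} (hf : MemLp f (ENNReal.ofReal p) m) :
    Integrable (fun x => |f x| ^ p) m := by
  have h := hf.integrable_norm_rpow (by simp; linarith) (by simp)
  simpa [ENNReal.toReal_ofReal (by linarith : 0 ≤ p)] using h

theorem integral_abs_rpow (hp : 1 < p) {f : X → ℝ} (hf : MemLp f (ENNReal.ofReal p) m) :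
    ∫ x, |f x| ^ p ∂m = (eLpNorm f (ENNReal.ofReal p) m).toReal ^ p := by
  have hp0 : 0 < p := by linarith
  have h0 : 0 ≤ ∫ x, |f x| ^ p ∂m := integral_nonneg fun x => by positivity
  rw [hf.eLpNorm_eq_integral_rpow_norm (by simp; linarith) (by simp),
    ENNReal.toReal_ofReal hp0.le]
  simp only [Real.norm_eq_abs]
  rw [ENNReal.toReal_ofReal (by positivity), ← Real.rpow_mul h0, inv_mul_cancel₀ hp0.ne',
    Real.rpow_one]

theorem aestronglyMeasurable_signedPow_mul {f h : X → ℝ} (hf : AEStronglyMeasurable f m)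
    (hh : AEStronglyMeasurable h m) :
    AEStronglyMeasurable (fun x => signedPow p (f x) * h x) m :=
  ((measurable_signedPow p).comp_aemeasurable hf.aemeasurable).aestronglyMeasurable.mul hh

theorem integrable_signedPow_mul (hp : 1 < p) {f h : X → ℝ} (hf : MemLp f (ENNReal.ofReal p) m)
    (hh : MemLp h (ENNReal.ofReal p) m) : Integrable (fun x => signedPow p (f x) * h x) m :=
  Integrable.mono' ((integrable_abs_rpow hp hf).add (integrable_abs_rpow hp hh))
    (aestronglyMeasurable_signedPow_mul hf.1 hh.1)
    (Eventually.of_forall fun _ => abs_signedPow_mul_le_add hp _ _)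

/-- Vanishing of `∫ |f|^(p-2) f h` passes to `L^p` limits in `h`. -/
theorem integral_signedPow_mul_eq_zero_of_tendsto (hp : 1 < p) {f w : X → ℝ} {φ : ℕ → X → ℝ}
    (hf : MemLp f (ENNReal.ofReal p) m) (hw : MemLp w (ENNReal.ofReal p) m)
    (hφ : ∀ k, MemLp (φ k) (ENNReal.ofReal p) m)
    (hlim : Tendsto (fun k => eLpNorm (w - φ k) (ENNReal.ofReal p) m) atTop (𝓝 0))
    (hz : ∀ k, ∫ x, signedPow p (f x) * φ k x ∂m = 0) :
    ∫ x, signedPow p (f x) * w x ∂m = 0 := by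
  have hp0 : 0 < p := by linarith
  set A := ∫ x, |f x| ^ p ∂m
  -- Young's inequality with a weight `t`, applied to `f` and `t⁻¹ (w - φ k)`. Letting `k → ∞`
  -- removes the second term, and then `t → 0` removes the first.
  have hbound : ∀ t : ℝ, 0 < t → ∀ k, |∫ x, signedPow p (f x) * w x ∂m| ≤
      t * A + t * ((t⁻¹) ^ p * (eLpNorm (w - φ k) (ENNReal.ofReal p) m).toReal ^ p) := by
    intro t ht k
    have hd := hw.sub (hφ k)
    have e : ∫ x, signedPow p (f x) * w x ∂m = ∫ x, signedPow p (f x) * (w - φ k) x ∂m := by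
      rw [← sub_zero (∫ x, signedPow p (f x) * w x ∂m), ← hz k,
        ← integral_sub (integrable_signedPow_mul hp hf hw) (integrable_signedPow_mul hp hf (hφ k))]
      simp [mul_sub]
    rw [e, ← integral_abs_rpow hp hd, ← integral_const_mul, ← integral_const_mul, ← integral_const_mul,
      ← integral_add ((integrable_abs_rpow hp hf).const_mul _)
      (((integrable_abs_rpow hp hd).const_mul _).const_mul _), ← Real.norm_eq_abs]
    refine norm_integral_le_of_norm_le (((integrable_abs_rpow hp hf).const_mul _).add
      (((integrable_abs_rpow hp hd).const_mul _).const_mul _)) (Eventually.of_forall fun x => ?_)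
    have h := abs_signedPow_mul_le_add hp (f x) (t⁻¹ * (w - φ k) x)
    rw [abs_mul t⁻¹, Real.mul_rpow (by positivity) (by positivity),
      abs_of_pos (inv_pos.2 ht)] at h
    have h' := mul_le_mul_of_nonneg_left h ht.le
    rw [Real.norm_eq_abs]
    calc |signedPow p (f x) * (w - φ k) x|
        = t * |signedPow p (f x) * (t⁻¹ * (w - φ k) x)| := by
          rw [abs_mul, abs_mul, abs_mul, abs_of_pos (inv_pos.2 ht)]
          field_simp
      _ ≤ _ := h'
      _ = _ := by ring
  have hreal : Tendsto (fun k => (eLpNorm (w - φ k) (ENNReal.ofReal p) m).toReal ^ p) atTop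
      (𝓝 0) := by
    have h := (ENNReal.tendsto_toReal ENNReal.zero_ne_top).comp hlim
    have h2 := h.rpow_const (p := p) (Or.inr hp0.le)
    simpa [Real.zero_rpow hp0.ne'] using h2
  have hb2 : ∀ t : ℝ, 0 < t → |∫ x, signedPow p (f x) * w x ∂m| ≤ t * A := fun t ht => by
    refine ge_of_tendsto (x := atTop) ?_ (Eventually.of_forall (hbound t ht))
    have := ((hreal.const_mul ((t⁻¹) ^ p)).const_mul t).const_add (t * A)
    simpa using this
  have hlim0 : Tendsto (fun t : ℝ => t * A) (𝓝[>] 0) (𝓝 0) := by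
    have : Tendsto (fun t : ℝ => t * A) (𝓝 0) (𝓝 (0 * A)) := tendsto_id.mul_const A
    rw [zero_mul] at this
    exact this.mono_left nhdsWithin_le_nhds
  exact abs_nonpos_iff.1 (ge_of_tendsto hlim0 (eventually_mem_nhdsWithin.mono fun t ht => hb2 t ht))

/-- The difference of the two integrals has the nonnegative integrand
$(|f|^{p-2}f-|g|^{p-2}g)(f-g)$, which vanishes only where $f=g$ by strict monotonicity. -/
theorem ae_eq_of_integral_signedPow_mul_sub_eq_zero (hp : 1 < p) {f g : X → ℝ}
    (hf : MemLp f (ENNReal.ofReal p) m) (hg : MemLp g (ENNReal.ofReal p) m)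
    (h1 : ∫ x, signedPow p (f x) * (f - g) x ∂m = 0)
    (h2 : ∫ x, signedPow p (g x) * (f - g) x ∂m = 0) : f =ᵐ[m] g := by
  have i1 := integrable_signedPow_mul hp hf (hf.sub hg)
  have i2 := integrable_signedPow_mul hp hg (hf.sub hg)
  have h : ∫ x, (signedPow p (f x) - signedPow p (g x)) * (f x - g x) ∂m = 0 := by
    have := integral_sub i1 i2
    rw [h1, h2, sub_zero] at this
    rw [← this]
    congr 1 with x
    simp [sub_mul]
  rw [integral_eq_zero_iff_of_nonneg (fun _ => signedPow_sub_mul_sub_nonneg hp _ _)] at h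
  · filter_upwards [h] with x hx using eq_of_signedPow_sub_mul_sub_eq_zero hp hx
  · refine (i1.sub i2).congr (Eventually.of_forall fun x => ?_)
    simp [sub_mul]

/-- The weights of Young's inequality are kept sharp and sum to one. Absorbing the first term then
gives minimality of energy with constant exactly one. -/
theorem integral_signedPow_mul_le (hp : 1 < p) {f h : X → ℝ} (hf : MemLp f (ENNReal.ofReal p) m)
    (hh : MemLp h (ENNReal.ofReal p) m) :
    ∫ x, signedPow p (f x) * h x ∂m ≤
      (1 - 1 / p) * ∫ x, |f x| ^ p ∂m + 1 / p * ∫ x, |h x| ^ p ∂m := by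
  rw [← integral_const_mul, ← integral_const_mul, ← integral_add
    ((integrable_abs_rpow hp hf).const_mul _) ((integrable_abs_rpow hp hh).const_mul _)]
  exact integral_mono (integrable_signedPow_mul hp hf hh)
    (((integrable_abs_rpow hp hf).const_mul _).add ((integrable_abs_rpow hp hh).const_mul _))
    fun x => (le_abs_self _).trans (abs_signedPow_mul_le hp _ _)

/-- Differentiation under the integral sign: for $|t|<1$ the derivative of the integrand is
dominated by $p\big((|f|+|h|)^p+|h|^p\big)$. -/
theorem hasDerivAt_integral_abs_add_rpow (hp : 1 < p) {f h : X → ℝ}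
    (hf : MemLp f (ENNReal.ofReal p) m) (hh : MemLp h (ENNReal.ofReal p) m) :
    HasDerivAt (fun t : ℝ => ∫ x, |f x + t * h x| ^ p ∂m)
      (∫ x, p * (signedPow p (f x) * h x) ∂m) 0 := by
  have hp0 : 0 < p := by linarith
  have hmem : ∀ t : ℝ, MemLp (fun x => f x + t * h x) (ENNReal.ofReal p) m := fun t =>
    hf.add (hh.const_mul t)
  have hfh : MemLp (fun x => |f x| + |h x|) (ENNReal.ofReal p) m := hf.abs.add hh.abs
  have key := (hasDerivAt_integral_of_dominated_loc_of_deriv_le (μ := m) (𝕜 := ℝ)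
    (F := fun t x => |f x + t * h x| ^ p)
    (F' := fun t x => p * (signedPow p (f x + t * h x) * h x)) (x₀ := 0)
    (s := Metric.ball 0 1) (bound := fun x => p * (|(|f x| + |h x|)| ^ p + |h x| ^ p))
    (Metric.ball_mem_nhds 0 one_pos)
    (Eventually.of_forall fun t => (integrable_abs_rpow hp (hmem t)).1)
    (integrable_abs_rpow hp (hmem 0))
    ((integrable_signedPow_mul hp (hmem 0) hh).1.const_mul p)
    (Eventually.of_forall fun x t ht => ?_)
    (((integrable_abs_rpow hp hfh).add (integrable_abs_rpow hp hh)).const_mul p)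
    (Eventually.of_forall fun x t _ => ?_)).2
  · simpa using key
  · rw [norm_mul, Real.norm_of_nonneg hp0.le]
    refine mul_le_mul_of_nonneg_left ((abs_signedPow_mul_le_add hp _ _).trans ?_) hp0.le
    have ht' : |t| ≤ 1 := by simpa using (mem_ball_zero_iff.1 ht).le
    have : |f x + t * h x| ≤ |(|f x| + |h x|)| := by
      rw [abs_of_nonneg (a := |f x| + |h x|) (by positivity)]
      refine (abs_add_le _ _).trans (add_le_add_right ?_ _)
      rw [abs_mul]
      exact mul_le_of_le_one_left (abs_nonneg _) ht'
    gcongr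
  · have h1 := (hasDerivAt_abs_rpow (f x + t * h x) hp).comp t
      (((hasDerivAt_id t).mul_const (h x)).const_add (f x))
    refine h1.congr_deriv ?_
    simp [signedPow]
    ring

theorem Lp.norm_rpow_eq_integral (hp : 1 < p) (f : Lp ℝ (ENNReal.ofReal p) m) :
    ‖f‖ ^ p = ∫ x, |f x| ^ p ∂m := by
  rw [integral_abs_rpow hp (Lp.memLp f), Lp.norm_def]

theorem Lp.norm_sub_rpow_le (hp : 1 < p) {ε C : ℝ}
    (hC : ∀ a b : ℝ, |a - b| ^ p ≤ ε * (|a| ^ p + |b| ^ p) +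
      C * ((|a| ^ p + |b| ^ p) / 2 - |(a + b) / 2| ^ p)) (f g : Lp ℝ (ENNReal.ofReal p) m) :
    ‖f - g‖ ^ p ≤ ε * (‖f‖ ^ p + ‖g‖ ^ p) +
      C * ((‖f‖ ^ p + ‖g‖ ^ p) / 2 - ‖(2 : ℝ)⁻¹ • (f + g)‖ ^ p) := by
  simp only [Lp.norm_rpow_eq_integral hp]
  have i := fun u : Lp ℝ (ENNReal.ofReal p) m => integrable_abs_rpow hp (Lp.memLp u)
  have i1 : Integrable (fun x => ε * (|f x| ^ p + |g x| ^ p)) m := ((i f).add (i g)).const_mul ε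
  have i2 : Integrable (fun x => (|f x| ^ p + |g x| ^ p) / 2) m := ((i f).add (i g)).div_const 2
  have i3 : Integrable (fun x => C * ((|f x| ^ p + |g x| ^ p) / 2 -
      |((2 : ℝ)⁻¹ • (f + g) : Lp ℝ (ENNReal.ofReal p) m) x| ^ p)) m :=
    (i2.sub (i _)).const_mul C
  rw [← integral_add (i f) (i g), ← integral_const_mul, ← integral_div,
    ← integral_sub i2 (i _), ← integral_const_mul, ← integral_add i1 i3]
  refine integral_mono_ae (i _) (i1.add i3) ?_
  filter_upwards [Lp.coeFn_sub f g, Lp.coeFn_smul (2 : ℝ)⁻¹ (f + g), Lp.coeFn_add f g]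
    with x h1 h2 h3
  rw [h1, h2, Pi.smul_apply, h3, Pi.sub_apply, Pi.add_apply, smul_eq_mul, inv_mul_eq_div]
  exact hC _ _

/-- In a translate of a closed subspace of `L^p`, `1 < p < ∞`, minimising sequences for the norm
are Cauchy. -/
theorem Lp.cauchySeq_of_tendsto_norm (hp : 1 < p) [Fact (1 ≤ ENNReal.ofReal p)] {d : ℝ}
    (hd : 0 ≤ d) {a : ℕ → Lp ℝ (ENNReal.ofReal p) m}
    (hmid : ∀ k l, d ≤ ‖(2 : ℝ)⁻¹ • (a k + a l)‖)
    (hlim : Tendsto (fun k => ‖a k‖) atTop (𝓝 d)) : CauchySeq a := by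
  have hp0 : 0 < p := by linarith
  have hlimp : Tendsto (fun k => ‖a k‖ ^ p) atTop (𝓝 (d ^ p)) :=
    hlim.rpow_const (Or.inr hp0.le)
  rw [Metric.cauchySeq_iff]
  intro η hη
  have hηp : 0 < η ^ p := Real.rpow_pos_of_pos hη p
  have hdp : 0 ≤ d ^ p := by positivity
  -- Eventually both $p$-th powers are at most $d^p+1$, so this `ε` makes the first term at most
  -- $\eta^p/2$. The constant `C` is known only afterwards, and the closeness $\eta^p/(4(C+1))$ to
  -- $d^p$ then makes the convexity term at most $\eta^p/4$.
  set ε := η ^ p / (4 * (d ^ p + 1)) with hε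
  have hε0 : 0 < ε := by positivity
  obtain ⟨C, hC0, hC⟩ := exists_abs_sub_rpow_le hp hε0
  have h1 : ∀ᶠ k in atTop, ‖a k‖ ^ p < d ^ p + min 1 (η ^ p / (4 * (C + 1))) :=
    hlimp.eventually_lt_const (by
      have : 0 < min 1 (η ^ p / (4 * (C + 1))) := by positivity
      linarith)
  obtain ⟨N, hN⟩ := eventually_atTop.1 h1
  refine ⟨N, fun k hk l hl => ?_⟩
  rw [dist_eq_norm]
  have hm : d ^ p ≤ ‖(2 : ℝ)⁻¹ • (a k + a l)‖ ^ p := Real.rpow_le_rpow hd (hmid k l) hp0.le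
  have hmain := Lp.norm_sub_rpow_le hp hC (a k) (a l)
  have hk1 := hN k hk
  have hl1 := hN l hl
  have m1 := min_le_left 1 (η ^ p / (4 * (C + 1)))
  have m2 := min_le_right 1 (η ^ p / (4 * (C + 1)))
  have e1 : ε * (‖a k‖ ^ p + ‖a l‖ ^ p) ≤ ε * (2 * (d ^ p + 1)) := by
    gcongr
    linarith
  have e2 : C * ((‖a k‖ ^ p + ‖a l‖ ^ p) / 2 - ‖(2 : ℝ)⁻¹ • (a k + a l)‖ ^ p) ≤
      C * (η ^ p / (4 * (C + 1))) := by
    gcongr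
    linarith
  have e3 : ε * (2 * (d ^ p + 1)) = η ^ p / 2 := by
    rw [hε]
    field_simp
    norm_num
  have e4 : C * (η ^ p / (4 * (C + 1))) ≤ η ^ p / 4 := by
    rw [mul_div_assoc', div_le_div_iff₀ (by positivity) (by norm_num)]
    nlinarith
  have hlt : ‖a k - a l‖ ^ p < η ^ p := by linarith
  exact lt_of_not_ge fun h => absurd (Real.rpow_le_rpow hη.le h hp0.le) (not_le.2 hlt)

/-- Existence of a minimiser of the norm on a translate of the closure of a subspace `V` of `L^p`,
characterised by its Euler-Lagrange equation. -/
theorem Lp.exists_integral_signedPow_mul_eq_zero (hp : 1 < p) [Fact (1 ≤ ENNReal.ofReal p)]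
    (V : Submodule ℝ (Lp ℝ (ENNReal.ofReal p) m)) (f : Lp ℝ (ENNReal.ofReal p) m) :
    ∃ g ∈ V.topologicalClosure, ∀ h ∈ V, ∫ x, signedPow p ((f + g) x) * h x ∂m = 0 := by
  have hp0 : 0 < p := by linarith
  set S : Set ℝ := (fun v => ‖f + v‖) '' (V.topologicalClosure : Set (Lp ℝ (ENNReal.ofReal p) m))
    with hS
  have hne : S.Nonempty := ⟨_, 0, V.topologicalClosure.zero_mem, rfl⟩
  have hbdd : BddBelow S := ⟨0, by rintro _ ⟨v, _, rfl⟩; exact norm_nonneg _⟩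
  set d := sInf S with hd
  have hd0 : 0 ≤ d := le_csInf hne (by rintro _ ⟨v, _, rfl⟩; exact norm_nonneg _)
  have hle : ∀ v ∈ V.topologicalClosure, d ≤ ‖f + v‖ := fun v hv => csInf_le hbdd ⟨v, hv, rfl⟩
  obtain ⟨u, -, hu, huS⟩ := exists_seq_tendsto_sInf hne hbdd
  choose v hv hvu using huS
  simp only at hvu
  have hvd : Tendsto (fun k => ‖f + v k‖) atTop (𝓝 d) := by simpa only [hvu] using hu
  have hc : CauchySeq fun k => f + v k := by
    refine Lp.cauchySeq_of_tendsto_norm hp hd0 (fun k l => ?_) hvd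
    have : (2 : ℝ)⁻¹ • (f + v k + (f + v l)) = f + (2 : ℝ)⁻¹ • (v k + v l) := by
      rw [show f + v k + (f + v l) = (2 : ℝ) • f + (v k + v l) by rw [two_smul]; abel, smul_add,
        smul_smul]
      norm_num
    rw [this]
    exact hle _ (V.topologicalClosure.smul_mem _ (V.topologicalClosure.add_mem (hv k) (hv l)))
  obtain ⟨b, hb⟩ := cauchySeq_tendsto_of_complete hc
  have hg : b - f ∈ V.topologicalClosure := by
    refine V.isClosed_topologicalClosure.mem_of_tendsto (hb.sub_const f)
      (Eventually.of_forall fun k => ?_)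
    simpa using hv k
  have hbd : ‖b‖ = d := tendsto_nhds_unique hb.norm hvd
  refine ⟨b - f, hg, fun h hh => ?_⟩
  rw [add_sub_cancel]
  have hder := hasDerivAt_integral_abs_add_rpow hp (Lp.memLp b) (Lp.memLp h)
  have heq : ∀ t : ℝ, ∫ x, |b x + t * h x| ^ p ∂m = ‖b + t • h‖ ^ p := fun t => by
    rw [Lp.norm_rpow_eq_integral hp]
    refine integral_congr_ae ?_
    filter_upwards [Lp.coeFn_add b (t • h), Lp.coeFn_smul t h] with x h1 h2
    rw [h1, Pi.add_apply, h2, Pi.smul_apply, smul_eq_mul]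
  -- The line `b + t • h` stays in the translate over which `b` has least norm.
  have hmin : IsLocalMin (fun t : ℝ => ∫ x, |b x + t * h x| ^ p ∂m) 0 := by
    refine Eventually.of_forall fun t => ?_
    simp only [heq, zero_smul, add_zero, hbd]
    refine Real.rpow_le_rpow hd0 ?_ hp0.le
    have := hle (b - f + t • h) (V.topologicalClosure.add_mem hg
      (V.topologicalClosure.smul_mem t (V.le_topologicalClosure hh)))
    rwa [show f + (b - f + t • h) = b + t • h by abel] at this
  have h0 := hmin.hasDerivAt_eq_zero hder
  rw [integral_const_mul] at h0
  exact (mul_eq_zero.1 h0).resolve_left hp0.ne'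

end Integral

/-! ### The Gagliardo seminorm as an $L^p$ norm of differences -/

theorem eLpNorm_ofReal_rpow {X : Type*} [MeasurableSpace X] {m : Measure X} {p : ℝ} (hp : 0 < p)
    (f : X → ℝ) : eLpNorm f (ENNReal.ofReal p) m ^ p = ∫⁻ x, ‖f x‖ₑ ^ p ∂m := by
  rw [eLpNorm_eq_lintegral_rpow_enorm_toReal (by simpa using hp) (by simp),
    ENNReal.toReal_ofReal hp.le, ← ENNReal.rpow_mul, one_div, inv_mul_cancel₀ hp.ne',
    ENNReal.rpow_one]

theorem ofReal_abs_rpow {p : ℝ} (hp : 0 ≤ p) (a : ℝ) : ENNReal.ofReal (|a| ^ p) = ‖a‖ₑ ^ p := by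
  rw [Real.enorm_eq_ofReal_abs, ENNReal.ofReal_rpow_of_nonneg (abs_nonneg a) hp]

variable {n : ℕ}

/-- The difference function `(x, y) ↦ u(x) - u(y)`. -/
def differences (u : EuclideanSpace ℝ (Fin n) → ℝ)
    (z : EuclideanSpace ℝ (Fin n) × EuclideanSpace ℝ (Fin n)) : ℝ :=
  u z.1 - u z.2

/-- The measure `|x - y|^(-r) dx dy`. -/
def kernelMeasure (n : ℕ) (r : ℝ) :
    Measure (EuclideanSpace ℝ (Fin n) × EuclideanSpace ℝ (Fin n)) :=
  volume.withDensity fun z => ENNReal.ofReal (1 / ‖z.1 - z.2‖ ^ r)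

theorem measurable_kernel (r : ℝ) :
    Measurable fun z : EuclideanSpace ℝ (Fin n) × EuclideanSpace ℝ (Fin n) =>
      ENNReal.ofReal (1 / ‖z.1 - z.2‖ ^ r) := by
  fun_prop

theorem kernelMeasure_absolutelyContinuous (r : ℝ) : kernelMeasure n r ≪ volume :=
  withDensity_absolutelyContinuous _ _

theorem lintegral_kernelMeasure (r : ℝ)
    (g : EuclideanSpace ℝ (Fin n) × EuclideanSpace ℝ (Fin n) → ℝ≥0∞) :
    ∫⁻ z, g z ∂kernelMeasure n r = ∫⁻ z, ENNReal.ofReal (1 / ‖z.1 - z.2‖ ^ r) * g z := by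
  rw [kernelMeasure, lintegral_withDensity_eq_lintegral_mul_non_measurable₀ _
    (measurable_kernel r).aemeasurable (by simp)]
  rfl

theorem differences_add (u v : EuclideanSpace ℝ (Fin n) → ℝ) :
    differences (u + v) = differences u + differences v := by
  ext z; simp [differences]; ring

theorem differences_sub (u v : EuclideanSpace ℝ (Fin n) → ℝ) :
    differences (u - v) = differences u - differences v := by
  ext z; simp [differences]; ring

theorem differences_smul (c : ℝ) (u : EuclideanSpace ℝ (Fin n) → ℝ) :
    differences (c • u) = c • differences u := by
  ext z; simp [differences]; ring

theorem ae_prod_of_ae {P : EuclideanSpace ℝ (Fin n) → Prop} (h : ∀ᵐ x, P x) :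
    ∀ᵐ z : EuclideanSpace ℝ (Fin n) × EuclideanSpace ℝ (Fin n), P z.1 ∧ P z.2 := by
  rw [Measure.volume_eq_prod]
  exact (Measure.quasiMeasurePreserving_fst.ae h).and (Measure.quasiMeasurePreserving_snd.ae h)

theorem MeasureTheory.AEStronglyMeasurable.differences {u : EuclideanSpace ℝ (Fin n) → ℝ}
    (hu : AEStronglyMeasurable u volume) (r : ℝ) :
    AEStronglyMeasurable (differences u) (kernelMeasure n r) := by
  refine AEStronglyMeasurable.mono_ac (kernelMeasure_absolutelyContinuous r) ?_
  rw [Measure.volume_eq_prod]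
  exact (hu.comp_quasiMeasurePreserving Measure.quasiMeasurePreserving_fst).sub
    (hu.comp_quasiMeasurePreserving Measure.quasiMeasurePreserving_snd)

/-- Absorbing the kernel into the measure turns the seminorm into an honest $L^p$ norm, so that
completeness and convexity of $L^p$ become available. -/
theorem gagliardoSeminorm_eq {s p : ℝ} (hp : 0 < p) (u : EuclideanSpace ℝ (Fin n) → ℝ) :
    gagliardoSeminorm s p u =
      eLpNorm (differences u) (ENNReal.ofReal p) (kernelMeasure n (n + s * p)) := by
  rw [eLpNorm_eq_lintegral_rpow_enorm_toReal (by simpa using hp) (by simp),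
    ENNReal.toReal_ofReal hp.le, lintegral_kernelMeasure, gagliardoSeminorm]
  congr 2 with z
  rw [← ofReal_abs_rpow hp.le, ← ENNReal.ofReal_mul (by positivity), differences]
  congr 1
  ring

/-! ### Kernel estimates near and away from the diagonal, and the Poincaré inequality -/

theorem lintegral_mul_comp_sub_fst {h k : EuclideanSpace ℝ (Fin n) → ℝ≥0∞}
    (hh : AEMeasurable h volume) (hk : Measurable k) :
    ∫⁻ z : EuclideanSpace ℝ (Fin n) × EuclideanSpace ℝ (Fin n), h z.1 * k (z.1 - z.2) =
      (∫⁻ x, h x) * ∫⁻ x, k x := by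
  rw [Measure.volume_eq_prod, lintegral_prod]
  · have h1 : ∀ x, ∫⁻ y, h x * k (x - y) = h x * ∫⁻ y, k y := fun x => by
      rw [lintegral_const_mul _ (by fun_prop : Measurable fun y => k (x - y)),
        lintegral_sub_left_eq_self]
    simp only [h1]
    exact lintegral_mul_const'' _ hh
  · exact (hh.comp_quasiMeasurePreserving Measure.quasiMeasurePreserving_fst).mul
      (hk.comp (measurable_fst.sub measurable_snd)).aemeasurable

theorem lintegral_mul_comp_sub_snd {h k : EuclideanSpace ℝ (Fin n) → ℝ≥0∞}
    (hh : AEMeasurable h volume) (hk : Measurable k) :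
    ∫⁻ z : EuclideanSpace ℝ (Fin n) × EuclideanSpace ℝ (Fin n), h z.2 * k (z.1 - z.2) =
      (∫⁻ x, h x) * ∫⁻ x, k x := by
  rw [Measure.volume_eq_prod, lintegral_prod_symm]
  · have h1 : ∀ y, ∫⁻ x, h y * k (x - y) = h y * ∫⁻ x, k x := fun y => by
      rw [lintegral_const_mul _ (by fun_prop : Measurable fun x => k (x - y)),
        lintegral_sub_right_eq_self]
    simp only [h1]
    exact lintegral_mul_const'' _ hh
  · exact (hh.comp_quasiMeasurePreserving Measure.quasiMeasurePreserving_snd).mul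
      (hk.comp (measurable_fst.sub measurable_snd)).aemeasurable

/-- The kernel `|z|^(-r)` cut off near the origin. -/
def farKernel (δ r : ℝ) : EuclideanSpace ℝ (Fin n) → ℝ≥0∞ :=
  {z | δ ≤ ‖z‖}.indicator fun z => ENNReal.ofReal (1 / ‖z‖ ^ r)

theorem measurable_farKernel (δ r : ℝ) :
    Measurable (farKernel δ r : EuclideanSpace ℝ (Fin n) → ℝ≥0∞) :=
  Measurable.indicator (by fun_prop) (measurableSet_le measurable_const measurable_norm)

/-- For $|z|\ge\delta$ one has $1+|z|\le(1/\delta+1)|z|$, so the kernel is dominated by a multiple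
of $(1+|z|)^{-r}$, integrable since $r>n$. -/
theorem lintegral_farKernel_lt_top {δ r : ℝ} (hδ : 0 < δ) (hr : n < r) :
    ∫⁻ z : EuclideanSpace ℝ (Fin n), farKernel δ r z < ⊤ := by
  have hr0 : 0 ≤ r := (Nat.cast_nonneg n).trans hr.le
  have hi : Integrable (fun z : EuclideanSpace ℝ (Fin n) =>
      (1 / δ + 1) ^ r * (1 + ‖z‖) ^ (-r)) volume :=
    (integrable_one_add_norm (by simpa using hr)).const_mul _
  refine lt_of_le_of_lt (lintegral_mono fun z => ?_) hi.lintegral_lt_top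
  rw [farKernel, Set.indicator_apply]
  split_ifs with hz
  · refine ENNReal.ofReal_le_ofReal ?_
    have hz' : δ ≤ ‖z‖ := hz
    have hz0 : 0 < ‖z‖ := hδ.trans_le hz'
    rw [Real.rpow_neg (by positivity), ← div_eq_mul_inv, ← Real.div_rpow (by positivity)
      (by positivity), ← Real.one_rpow r, ← Real.div_rpow zero_le_one hz0.le, Real.one_rpow]
    refine Real.rpow_le_rpow (by positivity) ?_ hr0
    rw [div_le_div_iff₀ hz0 (by positivity)]
    have : 1 ≤ 1 / δ * ‖z‖ := by rw [one_div_mul_eq_div, le_div_iff₀ hδ]; linarith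
    linarith
  · exact zero_le

/-- The part of the Gagliardo energy away from the diagonal is controlled by the `L^p` norm. -/
theorem exists_lintegral_far_le {p δ r : ℝ} (hp : 1 < p) (hδ : 0 < δ) (hr : n < r) :
    ∃ C : ℝ≥0∞, C ≠ ⊤ ∧ ∀ u : EuclideanSpace ℝ (Fin n) → ℝ, AEStronglyMeasurable u volume →
      ∫⁻ z in {z | δ ≤ ‖z.1 - z.2‖}, ‖differences u z‖ₑ ^ p ∂kernelMeasure n r ≤
        C * ∫⁻ x, ‖u x‖ₑ ^ p := by
  set T := ∫⁻ z : EuclideanSpace ℝ (Fin n), farKernel δ r z with hT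
  have hT' : T ≠ ⊤ := (lintegral_farKernel_lt_top hδ hr).ne
  refine ⟨2 ^ (p - 1) * (T + T), ENNReal.mul_ne_top
    (ENNReal.rpow_ne_top_of_nonneg (by linarith) (by simp)) (by simp [hT']), fun u hu => ?_⟩
  have hS : MeasurableSet {z : EuclideanSpace ℝ (Fin n) × EuclideanSpace ℝ (Fin n) |
      δ ≤ ‖z.1 - z.2‖} := measurableSet_le measurable_const (by fun_prop)
  have hup : AEMeasurable (fun x => ‖u x‖ₑ ^ p) volume := hu.enorm.pow_const p
  have hm1 : AEMeasurable (fun z : EuclideanSpace ℝ (Fin n) × EuclideanSpace ℝ (Fin n) =>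
      ‖u z.1‖ₑ ^ p * farKernel δ r (z.1 - z.2)) volume := by
    rw [Measure.volume_eq_prod]
    exact (hup.comp_quasiMeasurePreserving Measure.quasiMeasurePreserving_fst).mul
      ((measurable_farKernel δ r).comp (measurable_fst.sub measurable_snd)).aemeasurable
  rw [← lintegral_indicator hS, lintegral_kernelMeasure]
  calc _ ≤ ∫⁻ z : EuclideanSpace ℝ (Fin n) × EuclideanSpace ℝ (Fin n), 2 ^ (p - 1) *
        (‖u z.1‖ₑ ^ p * farKernel δ r (z.1 - z.2) +
          ‖u z.2‖ₑ ^ p * farKernel δ r (z.1 - z.2)) := by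
        refine lintegral_mono fun z => ?_
        by_cases hz : δ ≤ ‖z.1 - z.2‖
        · have hz' : z ∈ {z : EuclideanSpace ℝ (Fin n) × EuclideanSpace ℝ (Fin n) |
            δ ≤ ‖z.1 - z.2‖} := hz
          have hz'' : z.1 - z.2 ∈ {z : EuclideanSpace ℝ (Fin n) | δ ≤ ‖z‖} := hz
          rw [Set.indicator_of_mem hz', farKernel, Set.indicator_of_mem hz'', ← add_mul,
            ← mul_assoc, mul_comm]
          gcongr
          refine le_trans ?_ (ENNReal.rpow_add_le_mul_rpow_add_rpow _ _ hp.le)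
          exact ENNReal.rpow_le_rpow (enorm_sub_le) (by linarith)
        · have hz' : z ∉ {z : EuclideanSpace ℝ (Fin n) × EuclideanSpace ℝ (Fin n) |
            δ ≤ ‖z.1 - z.2‖} := hz
          rw [Set.indicator_of_notMem hz', mul_zero]
          exact zero_le
    _ = 2 ^ (p - 1) * (T + T) * ∫⁻ x, ‖u x‖ₑ ^ p := by
        rw [lintegral_const_mul' _ _ (ENNReal.rpow_ne_top_of_nonneg (by linarith) (by simp)),
          lintegral_add_left' hm1, lintegral_mul_comp_sub_fst hup (measurable_farKernel δ r),
          lintegral_mul_comp_sub_snd hup (measurable_farKernel δ r), ← hT]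
        ring

/-- Near the diagonal, the kernel of lower order is dominated by that of higher order. -/
theorem lintegral_near_le {δ r₁ r₂ : ℝ} (hδ : 0 < δ) (hr₁ : r₁ ≠ 0) (hr : r₁ ≤ r₂)
    (g : EuclideanSpace ℝ (Fin n) × EuclideanSpace ℝ (Fin n) → ℝ≥0∞) :
    ∫⁻ z in {z | δ ≤ ‖z.1 - z.2‖}ᶜ, g z ∂kernelMeasure n r₁ ≤
      ENNReal.ofReal (δ ^ (r₂ - r₁)) * ∫⁻ z, g z ∂kernelMeasure n r₂ := by
  have hS : MeasurableSet {z : EuclideanSpace ℝ (Fin n) × EuclideanSpace ℝ (Fin n) |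
      δ ≤ ‖z.1 - z.2‖} := measurableSet_le measurable_const (by fun_prop)
  rw [← lintegral_indicator hS.compl, lintegral_kernelMeasure, lintegral_kernelMeasure,
    ← lintegral_const_mul' _ _ ENNReal.ofReal_ne_top]
  refine lintegral_mono fun z => ?_
  simp only [Set.indicator_apply]
  split_ifs with hz
  · rw [← mul_assoc, ← ENNReal.ofReal_mul (by positivity)]
    gcongr
    have hz' : ‖z.1 - z.2‖ < δ := not_le.1 hz
    -- On the diagonal `r₁ ≠ 0` gives the kernel the value `1 / 0 = 0`.
    rcases (norm_nonneg (z.1 - z.2)).eq_or_lt with h0 | h0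
    · rw [← h0, Real.zero_rpow hr₁]
      simp only [div_zero]
      positivity
    · rw [mul_one_div, div_le_div_iff₀ (by positivity) (by positivity), one_mul]
      calc ‖z.1 - z.2‖ ^ r₂ = ‖z.1 - z.2‖ ^ (r₂ - r₁) * ‖z.1 - z.2‖ ^ r₁ := by
            rw [← Real.rpow_add h0]; ring_nf
        _ ≤ _ := by gcongr
  · simp

/-- A fractional Poincaré inequality for functions supported in a ball. -/
theorem exists_poincare (hn : 1 ≤ n) {s p : ℝ} (hs : 0 < s) (hp : 1 < p) :
    ∃ C : ℝ≥0∞, C ≠ ⊤ ∧ ∀ (x₀ : EuclideanSpace ℝ (Fin n)) (R : ℝ), 0 < R →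
      ∀ u : EuclideanSpace ℝ (Fin n) → ℝ, AEStronglyMeasurable u volume →
        (∀ᵐ x, x ∉ Metric.ball x₀ R → u x = 0) →
          ∫⁻ x, ‖u x‖ₑ ^ p ≤ C * ENNReal.ofReal (R ^ (s * p)) *
            ∫⁻ z, ‖differences u z‖ₑ ^ p ∂kernelMeasure n (n + s * p) := by
  have : NeZero n := ⟨by omega⟩
  have hp0 : 0 < p := by linarith
  have hsp : 0 < s * p := mul_pos hs hp0
  set r : ℝ := n + s * p with hr
  have hr0 : 0 < r := by positivity
  set ω : ℝ≥0∞ := volume (Metric.ball (0 : EuclideanSpace ℝ (Fin n)) 1) with hω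
  have hω0 : ω ≠ 0 := (Metric.measure_ball_pos _ _ one_pos).ne'
  have hω1 : ω ≠ ⊤ := measure_ball_lt_top.ne
  refine ⟨ENNReal.ofReal (4 ^ r) * ω⁻¹, ENNReal.mul_ne_top ENNReal.ofReal_ne_top
    (ENNReal.inv_ne_top.2 hω0), fun x₀ R hR u hu hu0 => ?_⟩
  obtain ⟨e, he⟩ : ∃ e : EuclideanSpace ℝ (Fin n), ‖e‖ = 1 :=
    ⟨EuclideanSpace.single 0 1, by simp⟩
  -- `A` is disjoint from the ball carrying `u` and lies within distance `4 * R` of each of its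
  -- points. Hence $|u(x)-u(y)|=|u(x)|$ for $x$ in that ball and $y\in A$, and these pairs alone
  -- contribute at least $|A|(4R)^{-n-sp}\|u\|_{L^p}^p$. Since $|A|$ scales like $R^n$, the factor
  -- $R^{sp}$ results.
  set A := Metric.ball (x₀ + (2 * R) • e) R with hA
  set c := ENNReal.ofReal (1 / (4 * R) ^ r) with hc
  have he2 : ‖(2 * R) • e‖ = 2 * R := by rw [norm_smul, he, mul_one, Real.norm_of_nonneg]; positivity
  have hdisj : ∀ y ∈ A, y ∉ Metric.ball x₀ R := fun y hy hy' => by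
    have h1 := dist_triangle_left (x₀ + (2 * R) • e) x₀ y
    rw [dist_self_add_left, he2] at h1
    have h2 := Metric.mem_ball.1 hy
    have h3 := Metric.mem_ball.1 hy'
    linarith
  have hdist : ∀ x ∈ Metric.ball x₀ R, ∀ y ∈ A, 0 < ‖x - y‖ ∧ ‖x - y‖ ≤ 4 * R := by
    intro x hx y hy
    refine ⟨norm_pos_iff.2 fun h => hdisj y hy (sub_eq_zero.1 h ▸ hx), ?_⟩
    rw [← dist_eq_norm]
    have h1 := dist_triangle x x₀ y
    have h2 := dist_triangle_left x₀ y (x₀ + (2 * R) • e)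
    rw [dist_self_add_left, he2] at h2
    have h3 := Metric.mem_ball.1 hx
    have h4 := Metric.mem_ball'.1 hy
    linarith
  have hAm : MeasurableSet A := Metric.isOpen_ball.measurableSet
  have hup : AEMeasurable (fun x => ‖u x‖ₑ ^ p) volume := hu.enorm.pow_const p
  have key : (∫⁻ x, ‖u x‖ₑ ^ p) * (c * volume A) ≤
      ∫⁻ z, ‖differences u z‖ₑ ^ p ∂kernelMeasure n r := by
    rw [lintegral_kernelMeasure, ← lintegral_indicator_const hAm, ← lintegral_prod_mul hup
      (measurable_const.indicator hAm).aemeasurable, ← Measure.volume_eq_prod]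
    refine lintegral_mono_ae ?_
    filter_upwards [ae_prod_of_ae hu0] with z ⟨hz1, hz2⟩
    by_cases hy : z.2 ∈ A
    · rw [Set.indicator_of_mem hy]
      by_cases hx : z.1 ∈ Metric.ball x₀ R
      · rw [differences, hz2 (hdisj _ hy), sub_zero, mul_comm]
        obtain ⟨h1, h2⟩ := hdist _ hx _ hy
        rw [hc]
        gcongr
      · rw [hz1 hx]
        simp [hp0]
    · rw [Set.indicator_of_notMem hy, mul_zero]
      exact zero_le
  have hone : c * volume A * (ENNReal.ofReal (4 ^ r) * ω⁻¹ * ENNReal.ofReal (R ^ (s * p))) = 1 := by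
    rw [hA, Measure.addHaar_ball _ _ hR.le, ← hω, finrank_euclideanSpace_fin]
    calc _ = (c * ENNReal.ofReal (R ^ n) * ENNReal.ofReal (4 ^ r) * ENNReal.ofReal (R ^ (s * p))) *
          (ω * ω⁻¹) := by ring
      _ = 1 := by
          rw [ENNReal.mul_inv_cancel hω0 hω1, mul_one, hc, ← ENNReal.ofReal_mul (by positivity),
            ← ENNReal.ofReal_mul (by positivity), ← ENNReal.ofReal_mul (by positivity),
            ← ENNReal.ofReal_one]
          congr 1
          rw [Real.mul_rpow (by norm_num) hR.le, hr, Real.rpow_add hR, Real.rpow_natCast]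
          have : (0 : ℝ) < 4 ^ (n + s * p) := by positivity
          field_simp
  calc ∫⁻ x, ‖u x‖ₑ ^ p = (∫⁻ x, ‖u x‖ₑ ^ p) * (c * volume A) *
        (ENNReal.ofReal (4 ^ r) * ω⁻¹ * ENNReal.ofReal (R ^ (s * p))) := by
        rw [mul_assoc, hone, mul_one]
    _ ≤ _ := by
        rw [mul_comm]
        gcongr

/-- In polar coordinates this is the integrability of $y^{n-1+a}$ on $(0,1)$. -/
theorem lintegral_indicator_norm_rpow_lt_top (hn : 1 ≤ n) {a : ℝ} (ha : -(n : ℝ) < a) :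
    ∫⁻ z : EuclideanSpace ℝ (Fin n),
      {z : EuclideanSpace ℝ (Fin n) | ‖z‖ < 1}.indicator (fun z => ENNReal.ofReal (‖z‖ ^ a)) z
        < ⊤ := by
  have : NeZero n := ⟨by omega⟩
  have h : Integrable (fun x : EuclideanSpace ℝ (Fin n) =>
      (Set.Iio 1).indicator (fun y : ℝ => y ^ a) ‖x‖) volume := by
    rw [integrable_fun_norm_addHaar volume (f := (Set.Iio 1).indicator (fun y : ℝ => y ^ a)),
      finrank_euclideanSpace_fin]
    have h1 : IntegrableOn (fun y : ℝ => y ^ ((n : ℝ) - 1 + a)) (Set.Ioo 0 1) volume :=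
      (intervalIntegral.integrableOn_Ioo_rpow_iff one_pos).2 (by linarith)
    rw [← integrable_indicator_iff measurableSet_Ioo] at h1
    rw [← integrable_indicator_iff measurableSet_Ioi]
    refine h1.congr (Eventually.of_forall fun y => ?_)
    by_cases hy0 : 0 < y
    · by_cases hy1 : y < 1
      · rw [Set.indicator_of_mem (show y ∈ Set.Ioo (0 : ℝ) 1 from ⟨hy0, hy1⟩),
          Set.indicator_of_mem (show y ∈ Set.Ioi (0 : ℝ) from hy0),
          Set.indicator_of_mem (show y ∈ Set.Iio (1 : ℝ) from hy1), smul_eq_mul,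
          ← Real.rpow_natCast, ← Real.rpow_add hy0, Nat.cast_sub hn, Nat.cast_one]
      · rw [Set.indicator_of_notMem (show y ∉ Set.Ioo (0 : ℝ) 1 from fun h => hy1 h.2),
          Set.indicator_of_mem (show y ∈ Set.Ioi (0 : ℝ) from hy0),
          Set.indicator_of_notMem (show y ∉ Set.Iio (1 : ℝ) from hy1), smul_zero]
    · rw [Set.indicator_of_notMem (show y ∉ Set.Ioo (0 : ℝ) 1 from fun h => hy0 h.1),
        Set.indicator_of_notMem (show y ∉ Set.Ioi (0 : ℝ) from hy0)]
  refine lt_of_le_of_lt (lintegral_mono fun z => ?_) h.lintegral_lt_top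
  by_cases hz : ‖z‖ < 1
  · rw [Set.indicator_of_mem (show z ∈ {z : EuclideanSpace ℝ (Fin n) | ‖z‖ < 1} from hz),
      Set.indicator_of_mem (show ‖z‖ ∈ Set.Iio (1 : ℝ) from hz)]
  · rw [Set.indicator_of_notMem (show z ∉ {z : EuclideanSpace ℝ (Fin n) | ‖z‖ < 1} from hz)]
    exact zero_le

/-- The Lipschitz bound replaces the integrand by $L^p|x-y|^{p-r}$, integrable at the origin because
$p-r>-n$. Since $|x-y|<1$, only $x$ in the compact 1-thickening of the support contributes. -/
theorem lintegral_near_lt_top (hn : 1 ≤ n) {p r : ℝ} (hp : 1 < p) (hr : r < n + p)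
    {φ : EuclideanSpace ℝ (Fin n) → ℝ} {L : NNReal} (hL : LipschitzWith L φ)
    (hc : HasCompactSupport φ) :
    ∫⁻ z in {z | 1 ≤ ‖z.1 - z.2‖}ᶜ, ‖differences φ z‖ₑ ^ p ∂kernelMeasure n r < ⊤ := by
  have hp0 : 0 < p := by linarith
  have hS : MeasurableSet {z : EuclideanSpace ℝ (Fin n) × EuclideanSpace ℝ (Fin n) |
      1 ≤ ‖z.1 - z.2‖} := measurableSet_le measurable_const (by fun_prop)
  set B := Metric.cthickening 1 (tsupport φ) with hB
  have hBc : IsCompact B := IsCompact.cthickening hc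
  set k : EuclideanSpace ℝ (Fin n) → ℝ≥0∞ :=
    {z : EuclideanSpace ℝ (Fin n) | ‖z‖ < 1}.indicator (fun z => ENNReal.ofReal (‖z‖ ^ (p - r)))
    with hk
  have hkm : Measurable k := Measurable.indicator (by fun_prop)
    (measurableSet_lt measurable_norm measurable_const)
  have hout : ∀ x y : EuclideanSpace ℝ (Fin n), ‖x - y‖ < 1 → x ∉ B → φ x = 0 ∧ φ y = 0 := by
    intro x y hxy hx
    refine ⟨image_eq_zero_of_notMem_tsupport fun h =>
      hx (Metric.self_subset_cthickening _ h),
      image_eq_zero_of_notMem_tsupport fun h => hx ?_⟩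
    exact Metric.mem_cthickening_of_dist_le x y 1 _ h (by rw [dist_eq_norm]; exact hxy.le)
  rw [← lintegral_indicator hS.compl, lintegral_kernelMeasure]
  calc _ ≤ ∫⁻ z : EuclideanSpace ℝ (Fin n) × EuclideanSpace ℝ (Fin n),
        (L : ℝ≥0∞) ^ p * (B.indicator 1 z.1 * k (z.1 - z.2)) := by
        refine lintegral_mono fun z => ?_
        by_cases hz : 1 ≤ ‖z.1 - z.2‖
        · rw [Set.indicator_of_notMem (show z ∉ {z : EuclideanSpace ℝ (Fin n) ×
            EuclideanSpace ℝ (Fin n) | 1 ≤ ‖z.1 - z.2‖}ᶜ from not_not.2 hz), mul_zero]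
          exact zero_le
        · rw [Set.indicator_of_mem (show z ∈ {z : EuclideanSpace ℝ (Fin n) ×
            EuclideanSpace ℝ (Fin n) | 1 ≤ ‖z.1 - z.2‖}ᶜ from hz)]
          have hz' : ‖z.1 - z.2‖ < 1 := not_le.1 hz
          by_cases hx : z.1 ∈ B
          · rw [Set.indicator_of_mem hx, Pi.one_apply, one_mul, hk, Set.indicator_of_mem
              (show z.1 - z.2 ∈ {z : EuclideanSpace ℝ (Fin n) | ‖z‖ < 1} from hz'),
              ← ofReal_abs_rpow hp0.le, ← ENNReal.ofReal_coe_nnreal,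
              ENNReal.ofReal_rpow_of_nonneg L.coe_nonneg hp0.le,
              ← ENNReal.ofReal_mul (by positivity), ← ENNReal.ofReal_mul (by positivity)]
            refine ENNReal.ofReal_le_ofReal ?_
            rcases (norm_nonneg (z.1 - z.2)).eq_or_lt with h0 | h0
            · have : z.1 = z.2 := sub_eq_zero.1 (norm_eq_zero.1 h0.symm)
              simp only [differences, this, sub_self, abs_zero, Real.zero_rpow hp0.ne', mul_zero]
              positivity
            · have h1 : |differences φ z| ≤ L * ‖z.1 - z.2‖ := by
                have := hL.dist_le_mul z.1 z.2
                rwa [dist_eq_norm, dist_eq_norm, Real.norm_eq_abs] at this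
              calc 1 / ‖z.1 - z.2‖ ^ r * |differences φ z| ^ p
                  ≤ 1 / ‖z.1 - z.2‖ ^ r * (L * ‖z.1 - z.2‖) ^ p := by gcongr
                _ = _ := by
                  rw [Real.mul_rpow L.coe_nonneg h0.le, Real.rpow_sub h0]
                  ring
          · obtain ⟨h1, h2⟩ := hout _ _ hz' hx
            simp [differences, h1, h2, hp0]
    _ = (L : ℝ≥0∞) ^ p * (volume B * ∫⁻ z, k z) := by
        rw [lintegral_const_mul' _ _ (ENNReal.rpow_ne_top_of_nonneg hp0.le (by simp)),
          lintegral_mul_comp_sub_fst (h := B.indicator 1)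
          (measurable_one.indicator hBc.isClosed.measurableSet).aemeasurable hkm,
          lintegral_indicator_one hBc.isClosed.measurableSet]
    _ < ⊤ := ENNReal.mul_lt_top (ENNReal.rpow_lt_top_of_nonneg hp0.le (by simp))
        (ENNReal.mul_lt_top hBc.measure_lt_top
          (lintegral_indicator_norm_rpow_lt_top hn (by linarith)))

/-- The energy is split at distance 1: the far part is controlled by the $L^p$ norm, the near part
by the Lipschitz bound, where $s<1$ enters. -/
theorem IsTestFunction.memSobolev (hn : 1 ≤ n) {s p : ℝ} (hs₀ : 0 < s) (hs₁ : s < 1) (hp : 1 < p)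
    {U : Set (EuclideanSpace ℝ (Fin n))} {φ : EuclideanSpace ℝ (Fin n) → ℝ}
    (hφ : IsTestFunction U φ) : MemSobolev s p φ := by
  have hp0 : 0 < p := by linarith
  have hsp : 0 < s * p := mul_pos hs₀ hp0
  have hmem : MemLp φ (ENNReal.ofReal p) volume :=
    hφ.1.continuous.memLp_of_hasCompactSupport hφ.2.1
  refine ⟨hmem, ?_⟩
  rw [gagliardoSeminorm_eq hp0, ← ENNReal.rpow_lt_top_iff_of_pos hp0, eLpNorm_ofReal_rpow hp0]
  obtain ⟨L, hL⟩ := ContDiff.lipschitzWith_of_hasCompactSupport hφ.2.1 hφ.1 (by simp)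
  obtain ⟨C, hC, hfar⟩ := exists_lintegral_far_le (n := n) (p := p) (δ := 1) (r := n + s * p) hp
    one_pos (by linarith)
  have hS : MeasurableSet {z : EuclideanSpace ℝ (Fin n) × EuclideanSpace ℝ (Fin n) |
      1 ≤ ‖z.1 - z.2‖} := measurableSet_le measurable_const (by fun_prop)
  rw [← lintegral_add_compl _ hS]
  refine ENNReal.add_lt_top.2 ⟨(hfar φ hmem.1).trans_lt (ENNReal.mul_lt_top hC.lt_top ?_),
    lintegral_near_lt_top hn hp (by nlinarith) hL hφ.2.1⟩
  rw [← eLpNorm_ofReal_rpow hp0]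
  exact ENNReal.rpow_lt_top_of_nonneg hp0.le hmem.2.ne

/-! ### Test functions and their Sobolev closure -/

theorem tendsto_eLpNorm_zero_of_le_smul {X ι : Type*} [MeasurableSpace X] {μ ν : Measure X}
    {c : ℝ≥0∞} (hc : c ≠ ⊤) (h : μ ≤ c • ν) {q : ℝ≥0∞} {l : Filter ι} {f : ι → X → ℝ}
    (hf : Tendsto (fun i => eLpNorm (f i) q ν) l (𝓝 0)) :
    Tendsto (fun i => eLpNorm (f i) q μ) l (𝓝 0) := by
  rcases eq_or_ne c 0 with rfl | h0
  · have : μ = 0 := by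
      rw [zero_smul] at h
      exact le_antisymm h (Measure.zero_le _)
    simpa [this] using tendsto_const_nhds
  have h2 : Tendsto (fun i => c ^ (1 / q).toReal • eLpNorm (f i) q ν) l (𝓝 0) := by
    have := ENNReal.Tendsto.const_mul (a := c ^ (1 / q).toReal) hf
      (Or.inr (ENNReal.rpow_ne_top_of_nonneg ENNReal.toReal_nonneg hc))
    simpa using this
  refine tendsto_of_tendsto_of_tendsto_of_le_of_le tendsto_const_nhds h2 (fun _ => zero_le)
    fun i => ?_
  rw [← eLpNorm_smul_measure_of_ne_zero h0]
  exact eLpNorm_mono_measure _ h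

theorem IsTestFunction.add {U : Set (EuclideanSpace ℝ (Fin n))}
    {φ ψ : EuclideanSpace ℝ (Fin n) → ℝ} (hφ : IsTestFunction U φ) (hψ : IsTestFunction U ψ) :
    IsTestFunction U (φ + ψ) :=
  ⟨hφ.1.add hψ.1, hφ.2.1.add hψ.2.1,
    (tsupport_add φ ψ).trans (Set.union_subset hφ.2.2 hψ.2.2)⟩

theorem IsTestFunction.const_smul {U : Set (EuclideanSpace ℝ (Fin n))}
    {φ : EuclideanSpace ℝ (Fin n) → ℝ} (hφ : IsTestFunction U φ) (c : ℝ) :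
    IsTestFunction U (c • φ) :=
  ⟨hφ.1.const_smul c, hφ.2.1.smul_left (f := fun _ => c),
    (closure_mono (Function.support_const_smul_subset c φ)).trans hφ.2.2⟩

theorem IsTestFunction.sub {U : Set (EuclideanSpace ℝ (Fin n))}
    {φ ψ : EuclideanSpace ℝ (Fin n) → ℝ} (hφ : IsTestFunction U φ) (hψ : IsTestFunction U ψ) :
    IsTestFunction U (φ - ψ) := by
  have := hφ.add (hψ.const_smul (-1))
  rwa [neg_one_smul, ← sub_eq_add_neg] at this

theorem isTestFunction_zero (U : Set (EuclideanSpace ℝ (Fin n))) : IsTestFunction U 0 :=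
  ⟨contDiff_const, HasCompactSupport.zero, by simp [tsupport]⟩

theorem IsTestFunction.eq_zero {U : Set (EuclideanSpace ℝ (Fin n))}
    {φ : EuclideanSpace ℝ (Fin n) → ℝ} (hφ : IsTestFunction U φ) {x : EuclideanSpace ℝ (Fin n)}
    (hx : x ∉ U) : φ x = 0 :=
  image_eq_zero_of_notMem_tsupport fun h => hx (hφ.2.2 h)

theorem IsTestFunction.memLp {U : Set (EuclideanSpace ℝ (Fin n))}
    {φ : EuclideanSpace ℝ (Fin n) → ℝ} (hφ : IsTestFunction U φ) (q : ℝ≥0∞) :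
    MemLp φ q volume :=
  hφ.1.continuous.memLp_of_hasCompactSupport hφ.2.1

theorem memSobolev_iff {s p : ℝ} (hp : 0 < p) {u : EuclideanSpace ℝ (Fin n) → ℝ} :
    MemSobolev s p u ↔ MemLp u (ENNReal.ofReal p) volume ∧
      MemLp (differences u) (ENNReal.ofReal p) (kernelMeasure n (n + s * p)) := by
  rw [MemSobolev, gagliardoSeminorm_eq hp]
  exact ⟨fun h => ⟨h.1, h.1.1.differences _, h.2⟩, fun h => ⟨h.1, h.2.2⟩⟩

theorem eLpNorm_le_sobolevNorm {s p : ℝ} (hs : 0 < s) (hp : 0 < p)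
    (u : EuclideanSpace ℝ (Fin n) → ℝ) :
    eLpNorm u (ENNReal.ofReal p) volume ≤ sobolevNorm s p u := by
  rw [sobolevNorm, if_neg hs.ne', one_div, ENNReal.le_rpow_inv_iff hp]
  exact le_self_add

theorem gagliardoSeminorm_le_sobolevNorm {s p : ℝ} (hs : 0 < s) (hp : 0 < p)
    (u : EuclideanSpace ℝ (Fin n) → ℝ) :
    gagliardoSeminorm s p u ≤ sobolevNorm s p u := by
  rw [sobolevNorm, if_neg hs.ne', one_div, ENNReal.le_rpow_inv_iff hp]
  exact le_add_self

theorem tendsto_sobolevNorm {ι : Type*} {l : Filter ι} {s p : ℝ} (hs : 0 < s) (hp : 0 < p)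
    {u : ι → EuclideanSpace ℝ (Fin n) → ℝ}
    (h1 : Tendsto (fun i => eLpNorm (u i) (ENNReal.ofReal p) volume) l (𝓝 0))
    (h2 : Tendsto (fun i => gagliardoSeminorm s p (u i)) l (𝓝 0)) :
    Tendsto (fun i => sobolevNorm s p (u i)) l (𝓝 0) := by
  simp only [sobolevNorm, if_neg hs.ne']
  have h := ((h1.ennrpow_const p).add (h2.ennrpow_const p)).ennrpow_const (1 / p)
  simpa [ENNReal.zero_rpow_of_pos hp, hp] using h

theorem MemSobolevTilde.exists_seq {s p : ℝ} (hs : 0 < s) (hp : 0 < p)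
    {Ω : Set (EuclideanSpace ℝ (Fin n))} {v : EuclideanSpace ℝ (Fin n) → ℝ}
    (hv : MemSobolevTilde s p Ω v) :
    ∃ φ : ℕ → EuclideanSpace ℝ (Fin n) → ℝ, (∀ k, IsTestFunction Ω (φ k)) ∧
      Tendsto (fun k => eLpNorm (v - φ k) (ENNReal.ofReal p) volume) atTop (𝓝 0) ∧
      Tendsto (fun k => eLpNorm (differences v - differences (φ k)) (ENNReal.ofReal p)
        (kernelMeasure n (n + s * p))) atTop (𝓝 0) := by
  obtain ⟨ε, -, hε, hlim⟩ := exists_seq_strictAnti_tendsto' (zero_lt_one' ℝ≥0∞)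
  choose φ hφ hφε using fun k => hv.2 (ε k) (hε k).1
  have hs' : Tendsto (fun k => sobolevNorm s p (v - φ k)) atTop (𝓝 0) :=
    tendsto_of_tendsto_of_tendsto_of_le_of_le tendsto_const_nhds hlim (fun _ => zero_le)
      fun k => (hφε k).le
  refine ⟨φ, hφ, tendsto_of_tendsto_of_tendsto_of_le_of_le tendsto_const_nhds hs'
    (fun _ => zero_le) fun k => eLpNorm_le_sobolevNorm hs hp _,
    tendsto_of_tendsto_of_tendsto_of_le_of_le tendsto_const_nhds hs'
    (fun _ => zero_le) fun k => ?_⟩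
  rw [← differences_sub, ← gagliardoSeminorm_eq hp]
  exact gagliardoSeminorm_le_sobolevNorm hs hp _

/-- Test functions on `Ω` vanish on its complement, and this survives $L^p$ limits. -/
theorem MemSobolevTilde.ae_eq_zero {s p : ℝ} (hs : 0 < s) (hp : 0 < p)
    {Ω : Set (EuclideanSpace ℝ (Fin n))} (hΩ : IsOpen Ω) {v : EuclideanSpace ℝ (Fin n) → ℝ}
    (hv : MemSobolevTilde s p Ω v) : ∀ᵐ x, x ∉ Ω → v x = 0 := by
  obtain ⟨φ, hφ, hlim, -⟩ := hv.exists_seq hs hp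
  have hm := hΩ.measurableSet.compl
  have h0 : eLpNorm v (ENNReal.ofReal p) (volume.restrict Ωᶜ) ≤ 0 := by
    refine ge_of_tendsto hlim (Eventually.of_forall fun k => ?_)
    have : v =ᵐ[volume.restrict Ωᶜ] v - φ k := by
      filter_upwards [ae_restrict_mem hm] with x hx
      simp [(hφ k).eq_zero hx]
    rw [eLpNorm_congr_ae this]
    exact eLpNorm_mono_measure _ Measure.restrict_le_self
  have h1 := (eLpNorm_eq_zero_iff hv.1.1.1.restrict (by simpa using hp)).1 (le_antisymm h0 zero_le)
  exact (ae_restrict_iff' hm).1 h1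

/-- The fractional Poincaré inequality on a bounded set. -/
theorem exists_eLpNorm_le_of_isBounded (hn : 1 ≤ n) {s p : ℝ} (hs : 0 < s) (hp : 1 < p)
    {Ω : Set (EuclideanSpace ℝ (Fin n))} (hΩb : Bornology.IsBounded Ω) :
    ∃ C : ℝ≥0∞, C ≠ ⊤ ∧ ∀ u : EuclideanSpace ℝ (Fin n) → ℝ, AEStronglyMeasurable u volume →
      (∀ᵐ x, x ∉ Ω → u x = 0) → eLpNorm u (ENNReal.ofReal p) volume ≤
        C * eLpNorm (differences u) (ENNReal.ofReal p) (kernelMeasure n (n + s * p)) := by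
  have hp0 : 0 < p := by linarith
  obtain ⟨R, hR, hΩR⟩ := hΩb.subset_ball_lt 0 0
  obtain ⟨C, hC, h⟩ := exists_poincare hn hs hp
  refine ⟨(C * ENNReal.ofReal (R ^ (s * p))) ^ (1 / p), ENNReal.rpow_ne_top_of_nonneg
    (by positivity) (ENNReal.mul_ne_top hC ENNReal.ofReal_ne_top), fun u hu hu0 => ?_⟩
  rw [← ENNReal.rpow_le_rpow_iff hp0, ENNReal.mul_rpow_of_nonneg _ _ hp0.le, ← ENNReal.rpow_mul,
    one_div_mul_cancel hp0.ne', ENNReal.rpow_one, eLpNorm_ofReal_rpow hp0, eLpNorm_ofReal_rpow hp0]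
  refine h 0 R hR u hu ?_
  filter_upwards [hu0] with x hx hx' using hx fun h => hx' (hΩR h)

/-! ### The weighted energy and well-posedness of the exterior value problem -/

/-- The measure `σ(x, y) |x - y|^(-r) dx dy`. -/
def weightedMeasure (r : ℝ) (σ : EuclideanSpace ℝ (Fin n) → EuclideanSpace ℝ (Fin n) → ℝ) :
    Measure (EuclideanSpace ℝ (Fin n) × EuclideanSpace ℝ (Fin n)) :=
  (kernelMeasure n r).withDensity fun z => ENNReal.ofReal (σ z.1 z.2)

section Weighted

variable {s p r l : ℝ} {σ : EuclideanSpace ℝ (Fin n) → EuclideanSpace ℝ (Fin n) → ℝ}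

theorem weightedMeasure_absolutelyContinuous :
    weightedMeasure r σ ≪ volume :=
  (withDensity_absolutelyContinuous _ _).trans (kernelMeasure_absolutelyContinuous r)

theorem aemeasurable_coefficient (hσ : AEMeasurable (Function.uncurry σ)) :
    AEMeasurable (fun z => σ z.1 z.2) (kernelMeasure n r) :=
  AEMeasurable.mono_ac hσ (kernelMeasure_absolutelyContinuous r)

theorem integral_weightedMeasure (hσ : AEMeasurable (Function.uncurry σ)) (hl : 0 < l)
    (hlσ : ∀ x y, l ≤ σ x y)
    (g : EuclideanSpace ℝ (Fin n) × EuclideanSpace ℝ (Fin n) → ℝ) :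
    ∫ z, g z ∂weightedMeasure r σ = ∫ z, σ z.1 z.2 * g z ∂kernelMeasure n r := by
  rw [weightedMeasure, integral_withDensity_eq_integral_toReal_smul₀
    (aemeasurable_coefficient hσ).ennreal_ofReal (by simp)]
  congr 1 with z
  rw [ENNReal.toReal_ofReal (hl.le.trans (hlσ _ _)), smul_eq_mul]

theorem integral_kernelMeasure
    (g : EuclideanSpace ℝ (Fin n) × EuclideanSpace ℝ (Fin n) → ℝ) :
    ∫ z, g z ∂kernelMeasure n r = ∫ z, 1 / ‖z.1 - z.2‖ ^ r * g z := by
  rw [kernelMeasure, integral_withDensity_eq_integral_toReal_smul₀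
    (measurable_kernel r).aemeasurable (by simp)]
  congr 1 with z
  rw [ENNReal.toReal_ofReal (by positivity), smul_eq_mul]

/-- Positivity of `σ` allows it to be a density. The weak equation becomes the Euler-Lagrange
equation of a plain $L^p$ norm. -/
theorem weightedPLaplacian_eq (hσ : AEMeasurable (Function.uncurry σ)) (hl : 0 < l)
    (hlσ : ∀ x y, l ≤ σ x y) (u φ : EuclideanSpace ℝ (Fin n) → ℝ) :
    weightedPLaplacian s p σ u φ =
      ∫ z, signedPow p (differences u z) * differences φ z ∂weightedMeasure (n + s * p) σ := by
  rw [integral_weightedMeasure hσ hl hlσ, integral_kernelMeasure, weightedPLaplacian]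
  congr 1 with z
  simp only [signedPow, differences]
  ring

theorem weightedMeasure_le (hσl : ∀ x y, σ x y ≤ l⁻¹) :
    weightedMeasure r σ ≤ ENNReal.ofReal l⁻¹ • kernelMeasure n r := by
  rw [← withDensity_const]
  exact withDensity_mono (Eventually.of_forall fun z => ENNReal.ofReal_le_ofReal (hσl _ _))

theorem kernelMeasure_le (hl : 0 < l) (hlσ : ∀ x y, l ≤ σ x y) :
    kernelMeasure n r ≤ ENNReal.ofReal l⁻¹ • weightedMeasure r σ := by
  have h : ENNReal.ofReal l • kernelMeasure n r ≤ weightedMeasure r σ := by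
    rw [← withDensity_const]
    exact withDensity_mono (Eventually.of_forall fun z => ENNReal.ofReal_le_ofReal (hlσ _ _))
  calc kernelMeasure n r = ENNReal.ofReal l⁻¹ • ENNReal.ofReal l • kernelMeasure n r := by
        rw [smul_smul, ← ENNReal.ofReal_mul (by positivity), inv_mul_cancel₀ hl.ne',
          ENNReal.ofReal_one, one_smul]
    _ ≤ _ := by gcongr

theorem memLp_weightedMeasure_iff (hl : 0 < l) (hlσ : ∀ x y, l ≤ σ x y ∧ σ x y ≤ l⁻¹)
    {q : ℝ≥0∞} {g : EuclideanSpace ℝ (Fin n) × EuclideanSpace ℝ (Fin n) → ℝ} :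
    MemLp g q (weightedMeasure r σ) ↔ MemLp g q (kernelMeasure n r) :=
  ⟨fun h => h.of_measure_le_smul ENNReal.ofReal_ne_top
      (kernelMeasure_le hl fun x y => (hlσ x y).1),
    fun h => h.of_measure_le_smul ENNReal.ofReal_ne_top
      (weightedMeasure_le fun x y => (hlσ x y).2)⟩

/-- By density, the equation may be tested with all of $\widetilde W^{s,p}(\Omega)$, in particular
with $u-f$. -/
theorem IsWeakSolution.integral_eq_zero (hn : 1 ≤ n) (hs₀ : 0 < s) (hs₁ : s < 1) (hp : 1 < p)
    (hσ : AEMeasurable (Function.uncurry σ)) (hl : 0 < l)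
    (hlσ : ∀ x y, l ≤ σ x y ∧ σ x y ≤ l⁻¹) {Ω : Set (EuclideanSpace ℝ (Fin n))}
    {f u v : EuclideanSpace ℝ (Fin n) → ℝ} (hu : IsWeakSolution Ω s p σ f u)
    (hv : MemSobolevTilde s p Ω v) :
    ∫ z, signedPow p (differences u z) * differences v z ∂weightedMeasure (n + s * p) σ = 0 := by
  have hp0 : 0 < p := by linarith
  obtain ⟨φ, hφ, -, hlim⟩ := hv.exists_seq hs₀ hp0
  have hmem : ∀ w : EuclideanSpace ℝ (Fin n) → ℝ, MemSobolev s p w →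
      MemLp (differences w) (ENNReal.ofReal p) (weightedMeasure (n + s * p) σ) := fun w hw =>
    (memLp_weightedMeasure_iff hl hlσ).2 ((memSobolev_iff hp0).1 hw).2
  refine integral_signedPow_mul_eq_zero_of_tendsto hp (hmem u hu.1) (hmem v hv.1)
    (fun k => hmem _ ((hφ k).memSobolev hn hs₀ hs₁ hp))
    (tendsto_eLpNorm_zero_of_le_smul ENNReal.ofReal_ne_top
      (weightedMeasure_le fun x y => (hlσ x y).2) hlim) fun k => ?_
  rw [← weightedPLaplacian_eq hσ hl fun x y => (hlσ x y).1]
  exact hu.2.1 _ (hφ k)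

/-- Both equations are tested with $u-v=(u-f)-(v-f)$. Strict monotonicity gives $du=dv$ almost
everywhere, and the Poincaré inequality on `Ω` turns this into $u=v$. -/
theorem IsWeakSolution.ae_eq (hn : 1 ≤ n) (hs₀ : 0 < s) (hs₁ : s < 1) (hp : 1 < p)
    (hσ : AEMeasurable (Function.uncurry σ)) (hl : 0 < l)
    (hlσ : ∀ x y, l ≤ σ x y ∧ σ x y ≤ l⁻¹) {Ω : Set (EuclideanSpace ℝ (Fin n))}
    (hΩ : IsOpen Ω) (hΩb : Bornology.IsBounded Ω) {f u v : EuclideanSpace ℝ (Fin n) → ℝ}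
    (hu : IsWeakSolution Ω s p σ f u) (hv : IsWeakSolution Ω s p σ f v) : u =ᵐ[volume] v := by
  have hp0 : 0 < p := by linarith
  have hmem : ∀ w : EuclideanSpace ℝ (Fin n) → ℝ, MemSobolev s p w →
      MemLp (differences w) (ENNReal.ofReal p) (weightedMeasure (n + s * p) σ) := fun w hw =>
    (memLp_weightedMeasure_iff hl hlσ).2 ((memSobolev_iff hp0).1 hw).2
  have hz : ∀ w, IsWeakSolution Ω s p σ f w → ∫ z, signedPow p (differences w z) *
      (differences u - differences v) z ∂weightedMeasure (n + s * p) σ = 0 := by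
    intro w hw
    have h1 := hw.integral_eq_zero hn hs₀ hs₁ hp hσ hl hlσ hu.2.2
    have h2 := hw.integral_eq_zero hn hs₀ hs₁ hp hσ hl hlσ hv.2.2
    have h3 := integral_sub (integrable_signedPow_mul hp (hmem w hw.1) (hmem _ hu.2.2.1))
      (integrable_signedPow_mul hp (hmem w hw.1) (hmem _ hv.2.2.1))
    rw [h1, h2, sub_zero] at h3
    rw [← h3]
    congr 1 with z
    rw [← mul_sub, differences_sub, differences_sub]
    simp
  have hD := ae_eq_of_integral_signedPow_mul_sub_eq_zero hp (hmem u hu.1) (hmem v hv.1)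
    (hz u hu) (hz v hv)
  have hD' : eLpNorm (differences (u - v)) (ENNReal.ofReal p) (kernelMeasure n (n + s * p)) = 0 := by
    rw [differences_sub]
    have h0 : differences u - differences v =ᵐ[weightedMeasure (n + s * p) σ] 0 := by
      filter_upwards [hD] with z hzz
      simp [hzz]
    have h1 : differences u - differences v =ᵐ[kernelMeasure n (n + s * p)] 0 :=
      (Measure.absolutelyContinuous_of_le_smul (kernelMeasure_le hl fun x y => (hlσ x y).1)).ae_eq
        h0
    rw [eLpNorm_congr_ae h1, eLpNorm_zero]
  obtain ⟨C, -, hC⟩ := exists_eLpNorm_le_of_isBounded hn hs₀ hp hΩb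
  have hmeas := hu.1.1.1.sub hv.1.1.1
  have h := hC (u - v) hmeas (by
    filter_upwards [hu.2.2.ae_eq_zero hs₀ hp0 hΩ, hv.2.2.ae_eq_zero hs₀ hp0 hΩ] with x h1 h2 hx
    have h1 := h1 hx
    have h2 := h2 hx
    simp only [Pi.sub_apply] at h1 h2 ⊢
    linarith)
  rw [hD', mul_zero] at h
  filter_upwards [(eLpNorm_eq_zero_iff hmeas (by simpa using hp0)).1 (le_antisymm h zero_le)]
    with x hx
  exact sub_eq_zero.1 hx

/-- The differences of test functions, as a subspace of the weighted `L^p` space. -/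
def testDifferences (q : ℝ≥0∞) (r : ℝ)
    (σ : EuclideanSpace ℝ (Fin n) → EuclideanSpace ℝ (Fin n) → ℝ)
    (Ω : Set (EuclideanSpace ℝ (Fin n))) : Submodule ℝ (Lp ℝ q (weightedMeasure r σ)) where
  carrier := {g | ∃ φ, IsTestFunction Ω φ ∧ g =ᵐ[weightedMeasure r σ] differences φ}
  zero_mem' := ⟨0, isTestFunction_zero Ω, by
    filter_upwards [Lp.coeFn_zero ℝ q (weightedMeasure r σ)] with z hz
    rw [hz]
    simp [differences]⟩
  add_mem' := by
    rintro a b ⟨φ, hφ, ha⟩ ⟨ψ, hψ, hb⟩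
    refine ⟨φ + ψ, hφ.add hψ, ?_⟩
    rw [differences_add]
    exact (Lp.coeFn_add a b).trans (ha.add hb)
  smul_mem' := by
    rintro c a ⟨φ, hφ, ha⟩
    refine ⟨c • φ, hφ.const_smul c, ?_⟩
    rw [differences_smul]
    exact (Lp.coeFn_smul c a).trans (ha.const_smul c)

/-- If the differences of test functions converge in the weighted `L^p` space, then the test
functions converge in `L^p`, to a function whose differences are the limit. -/
theorem exists_limit_of_tendsto_differences (hn : 1 ≤ n) (hs₀ : 0 < s) (hp : 1 < p)
    (hl : 0 < l) (hlσ : ∀ x y, l ≤ σ x y ∧ σ x y ≤ l⁻¹) {Ω : Set (EuclideanSpace ℝ (Fin n))}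
    (hΩb : Bornology.IsBounded Ω) {φ : ℕ → EuclideanSpace ℝ (Fin n) → ℝ}
    (hφ : ∀ k, IsTestFunction Ω (φ k))
    {g : EuclideanSpace ℝ (Fin n) × EuclideanSpace ℝ (Fin n) → ℝ}
    (hg : MemLp g (ENNReal.ofReal p) (weightedMeasure (n + s * p) σ))
    (hlim : Tendsto (fun k => eLpNorm (differences (φ k) - g) (ENNReal.ofReal p)
      (weightedMeasure (n + s * p) σ)) atTop (𝓝 0)) :
    ∃ v : EuclideanSpace ℝ (Fin n) → ℝ, MemLp v (ENNReal.ofReal p) volume ∧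
      Tendsto (fun k => eLpNorm (φ k - v) (ENNReal.ofReal p) volume) atTop (𝓝 0) ∧
      differences v =ᵐ[weightedMeasure (n + s * p) σ] g := by
  have hp0 : 0 < p := by linarith
  have hq0 : ENNReal.ofReal p ≠ 0 := by simpa using hp0
  have : Fact (1 ≤ ENNReal.ofReal p) := ⟨by simpa using hp.le⟩
  set W := weightedMeasure (n + s * p) σ with hW
  set K := kernelMeasure n (n + s * p) with hK
  have hac : W ≪ K := withDensity_absolutelyContinuous _ _
  have hlimK : Tendsto (fun k => eLpNorm (differences (φ k) - g) (ENNReal.ofReal p) K) atTop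
      (𝓝 0) := tendsto_eLpNorm_zero_of_le_smul ENNReal.ofReal_ne_top
        (kernelMeasure_le hl fun x y => (hlσ x y).1) hlim
  have hgK : AEStronglyMeasurable g K := ((memLp_weightedMeasure_iff hl hlσ).1 hg).1
  have hDm : ∀ k, AEStronglyMeasurable (differences (φ k)) K := fun k =>
    ((hφ k).memLp (ENNReal.ofReal p)).1.differences _
  obtain ⟨C, hC, hPoin⟩ := exists_eLpNorm_le_of_isBounded hn hs₀ hp hΩb
  -- The Poincaré inequality transfers the Cauchy property from the differences to the test
  -- functions.
  have hbound : ∀ k j, eLpNorm (φ k - φ j) (ENNReal.ofReal p) volume ≤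
      C * (eLpNorm (differences (φ k) - g) (ENNReal.ofReal p) K +
        eLpNorm (differences (φ j) - g) (ENNReal.ofReal p) K) := by
    intro k j
    refine (hPoin _ (((hφ k).sub (hφ j)).memLp (ENNReal.ofReal p)).1
      (Eventually.of_forall fun x hx => ((hφ k).sub (hφ j)).eq_zero hx)).trans ?_
    gcongr
    rw [differences_sub, ← sub_sub_sub_cancel_right _ _ g]
    exact eLpNorm_sub_le ((hDm k).sub hgK) ((hDm j).sub hgK) Fact.out
  have hmem := fun k => (hφ k).memLp (ENNReal.ofReal p)
  have hcauchy : CauchySeq fun k => (hmem k).toLp := by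
    rw [EMetric.cauchySeq_iff]
    intro ε hε
    have h2 : Tendsto (fun k => C * eLpNorm (differences (φ k) - g) (ENNReal.ofReal p) K) atTop
        (𝓝 0) := by simpa using ENNReal.Tendsto.const_mul hlimK (Or.inr hC)
    obtain ⟨N, hN⟩ := eventually_atTop.1 (h2.eventually_lt_const (ENNReal.half_pos hε.ne'))
    refine ⟨N, fun k hk j hj => ?_⟩
    rw [Lp.edist_toLp_toLp]
    refine (hbound k j).trans_lt ?_
    rw [mul_add, ← ENNReal.add_halves ε]
    exact ENNReal.add_lt_add (hN k hk) (hN j hj)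
  obtain ⟨v, hv⟩ := cauchySeq_tendsto_of_complete hcauchy
  have hvlim : Tendsto (fun k => eLpNorm (φ k - ⇑v) (ENNReal.ofReal p) volume) atTop (𝓝 0) := by
    refine ((Lp.tendsto_Lp_iff_tendsto_eLpNorm' _ _).1 hv).congr fun k => ?_
    exact eLpNorm_congr_ae ((hmem k).coeFn_toLp.sub (EventuallyEq.refl _ _))
  refine ⟨v, Lp.memLp v, hvlim, ?_⟩
  -- The two limits are identified pointwise: `φ` converges almost everywhere along `ns`, and the
  -- differences do so along the further subsequence `ms`.
  obtain ⟨ns, hns, hae⟩ := (tendstoInMeasure_of_tendsto_eLpNorm hq0 (fun k => (hmem k).1)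
    (Lp.memLp v).1 hvlim).exists_seq_tendsto_ae
  obtain ⟨ms, hms, hae'⟩ := (tendstoInMeasure_of_tendsto_eLpNorm hq0
    (fun k => (hDm (ns k)).mono_ac hac) hg.1
    (hlim.comp hns.tendsto_atTop)).exists_seq_tendsto_ae
  filter_upwards [hae', weightedMeasure_absolutelyContinuous.ae_le (ae_prod_of_ae hae)]
    with z hz1 ⟨hz2, hz3⟩
  exact tendsto_nhds_unique ((hz2.sub hz3).comp hms.tendsto_atTop) hz1

/-- The energy is minimised among $df+g$ with $g$ in the closure of the differences of test
functions. The minimising `g` is itself $dv$ for some $v\in\widetilde W^{s,p}(\Omega)$, and $f+v$ is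
the solution. -/
theorem exists_isWeakSolution (hn : 1 ≤ n) (hs₀ : 0 < s) (hs₁ : s < 1) (hp : 1 < p)
    (hσ : AEMeasurable (Function.uncurry σ)) (hl : 0 < l)
    (hlσ : ∀ x y, l ≤ σ x y ∧ σ x y ≤ l⁻¹) {Ω : Set (EuclideanSpace ℝ (Fin n))}
    (hΩb : Bornology.IsBounded Ω) {f : EuclideanSpace ℝ (Fin n) → ℝ} (hf : MemSobolev s p f) :
    ∃ u, IsWeakSolution Ω s p σ f u := by
  have hp0 : 0 < p := by linarith
  have : Fact (1 ≤ ENNReal.ofReal p) := ⟨by simpa using hp.le⟩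
  have hmem : ∀ w : EuclideanSpace ℝ (Fin n) → ℝ, MemSobolev s p w →
      MemLp (differences w) (ENNReal.ofReal p) (weightedMeasure (n + s * p) σ) := fun w hw =>
    (memLp_weightedMeasure_iff hl hlσ).2 ((memSobolev_iff hp0).1 hw).2
  obtain ⟨g, hg, hEL⟩ := Lp.exists_integral_signedPow_mul_eq_zero hp
    (testDifferences (ENNReal.ofReal p) (n + s * p) σ Ω) (hmem f hf).toLp
  obtain ⟨G, hG, hGlim⟩ := mem_closure_iff_seq_limit.1 hg
  choose φ hφ hGφ using hG
  have hlim : Tendsto (fun k => eLpNorm (differences (φ k) - ⇑g) (ENNReal.ofReal p)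
      (weightedMeasure (n + s * p) σ)) atTop (𝓝 0) := by
    refine ((Lp.tendsto_Lp_iff_tendsto_eLpNorm' _ _).1 hGlim).congr fun k => ?_
    exact eLpNorm_congr_ae ((hGφ k).sub (EventuallyEq.refl _ _))
  obtain ⟨v, hv, hvlim, hDv⟩ := exists_limit_of_tendsto_differences hn hs₀ hp hl hlσ hΩb hφ
    (Lp.memLp g) hlim
  have hDvmem : MemLp (differences v) (ENNReal.ofReal p) (weightedMeasure (n + s * p) σ) :=
    (Lp.memLp g).ae_eq hDv.symm
  have hvS : MemSobolev s p v :=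
    (memSobolev_iff hp0).2 ⟨hv, (memLp_weightedMeasure_iff hl hlσ).1 hDvmem⟩
  have huS : MemSobolev s p (f + v) := by
    rw [memSobolev_iff hp0, differences_add]
    exact ⟨hf.1.add hv, ((memSobolev_iff hp0).1 hf).2.add ((memSobolev_iff hp0).1 hvS).2⟩
  refine ⟨f + v, huS, fun ψ hψ => ?_, ?_⟩
  · have hψm := hmem ψ (hψ.memSobolev hn hs₀ hs₁ hp)
    rw [weightedPLaplacian_eq hσ hl fun x y => (hlσ x y).1,
      ← hEL hψm.toLp ⟨ψ, hψ, hψm.coeFn_toLp⟩]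
    refine integral_congr_ae ?_
    filter_upwards [hψm.coeFn_toLp, Lp.coeFn_add (hmem f hf).toLp g, (hmem f hf).coeFn_toLp, hDv]
      with z h1 h2 h3 h4
    rw [h1, h2, Pi.add_apply, h3, ← h4, differences_add, Pi.add_apply]
  · rw [add_sub_cancel_left]
    refine ⟨hvS, fun ε hε => ?_⟩
    have h1 : Tendsto (fun k => eLpNorm (v - φ k) (ENNReal.ofReal p) volume) atTop (𝓝 0) := by
      simpa only [eLpNorm_sub_comm] using hvlim
    have h2 : Tendsto (fun k => gagliardoSeminorm s p (v - φ k)) atTop (𝓝 0) := by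
      simp only [gagliardoSeminorm_eq hp0, differences_sub]
      refine tendsto_eLpNorm_zero_of_le_smul ENNReal.ofReal_ne_top
        (kernelMeasure_le hl fun x y => (hlσ x y).1) (hlim.congr fun k => ?_)
      rw [eLpNorm_sub_comm]
      exact eLpNorm_congr_ae (hDv.symm.sub (EventuallyEq.refl _ _))
    obtain ⟨k, hk⟩ := ((tendsto_sobolevNorm hs₀ hp0 h1 h2).eventually_lt_const hε).exists
    exact ⟨φ k, hφ k, hk⟩

end Weighted

/-! ### Concentrating test functions -/

theorem IsTestFunction.mono {U V : Set (EuclideanSpace ℝ (Fin n))}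
    {φ : EuclideanSpace ℝ (Fin n) → ℝ} (hφ : IsTestFunction U φ) (h : U ⊆ V) :
    IsTestFunction V φ :=
  ⟨hφ.1, hφ.2.1, hφ.2.2.trans h⟩

/-- A bump function is divided by its seminorm, which is nonzero by the Poincaré inequality. -/
theorem exists_isTestFunction_gagliardoSeminorm_eq_one (hn : 1 ≤ n) {s p : ℝ} (hs₀ : 0 < s)
    (hs₁ : s < 1) (hp : 1 < p) (x₀ : EuclideanSpace ℝ (Fin n)) {R : ℝ} (hR : 0 < R) :
    ∃ φ, IsTestFunction (Metric.ball x₀ R) φ ∧ gagliardoSeminorm s p φ = 1 := by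
  have hp0 : 0 < p := by linarith
  let b : ContDiffBump x₀ := ⟨R / 4, R / 2, by positivity, by linarith⟩
  have hb : IsTestFunction (Metric.ball x₀ R) b :=
    ⟨b.contDiff, b.hasCompactSupport, by
      rw [b.tsupport_eq]
      exact Metric.closedBall_subset_ball (by change R / 2 < R; linarith)⟩
  have hfin := (hb.memSobolev hn hs₀ hs₁ hp).2.ne
  have hpos : gagliardoSeminorm s p b ≠ 0 := by
    intro h0
    obtain ⟨C, -, hC⟩ := exists_eLpNorm_le_of_isBounded hn hs₀ hp (Metric.isBounded_ball (x := x₀)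
      (r := R))
    have h := hC b (hb.memLp (ENNReal.ofReal p)).1
      (Eventually.of_forall fun x hx => hb.eq_zero hx)
    rw [← gagliardoSeminorm_eq hp0, h0, mul_zero] at h
    have h1 := (eLpNorm_eq_zero_iff (hb.memLp (ENNReal.ofReal p)).1 (by simpa using hp0)).1
      (le_antisymm h zero_le)
    have h2 := (Continuous.ae_eq_iff_eq volume hb.1.continuous
      (continuous_const (y := (0 : ℝ)))).1 h1
    have h3 : b x₀ = 1 := b.one_of_mem_closedBall (Metric.mem_closedBall_self b.rIn_pos.le)
    rw [h2] at h3
    exact zero_ne_one h3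
  refine ⟨(gagliardoSeminorm s p b).toReal⁻¹ • ⇑b, hb.const_smul _, ?_⟩
  rw [gagliardoSeminorm_eq hp0, differences_smul, eLpNorm_const_smul, ← gagliardoSeminorm_eq hp0,
    Real.enorm_of_nonneg (by positivity), ENNReal.ofReal_inv_of_pos
    (ENNReal.toReal_pos hpos hfin), ENNReal.ofReal_toReal hfin, ENNReal.inv_mul_cancel hpos hfin]

section Concentration

variable {s p : ℝ} {x₀ : EuclideanSpace ℝ (Fin n)} {Φ : ℕ → EuclideanSpace ℝ (Fin n) → ℝ}
  {R : ℕ → ℝ}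

theorem lintegral_differences_eq_one (hp : 0 < p) {u : EuclideanSpace ℝ (Fin n) → ℝ}
    (hu : gagliardoSeminorm s p u = 1) :
    ∫⁻ z, ‖differences u z‖ₑ ^ p ∂kernelMeasure n (n + s * p) = 1 := by
  rw [← eLpNorm_ofReal_rpow hp, ← gagliardoSeminorm_eq hp, hu, ENNReal.one_rpow]

/-- With unit energy, the Poincaré inequality bounds the integral by a multiple of $R_N^{sp}$. -/
theorem tendsto_lintegral_of_concentrating (hn : 1 ≤ n) (hs₀ : 0 < s) (hp : 1 < p)
    (hR : ∀ N, 0 < R N) (hR0 : Tendsto R atTop (𝓝 0))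
    (hΦ : ∀ N, IsTestFunction (Metric.ball x₀ (R N)) (Φ N))
    (hΦ1 : ∀ N, gagliardoSeminorm s p (Φ N) = 1) :
    Tendsto (fun N => ∫⁻ x, ‖Φ N x‖ₑ ^ p) atTop (𝓝 0) := by
  have hp0 : 0 < p := by linarith
  have hsp : 0 < s * p := mul_pos hs₀ hp0
  obtain ⟨C, hC, h⟩ := exists_poincare hn hs₀ hp
  have h1 : Tendsto (fun N => C * ENNReal.ofReal (R N ^ (s * p))) atTop (𝓝 0) := by
    have h2 := (ENNReal.continuous_ofReal.tendsto _).comp (hR0.rpow_const (p := s * p)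
      (Or.inr hsp.le))
    rw [Real.zero_rpow hsp.ne', ENNReal.ofReal_zero] at h2
    simpa using ENNReal.Tendsto.const_mul h2 (Or.inr hC)
  refine tendsto_of_tendsto_of_tendsto_of_le_of_le tendsto_const_nhds h1 (fun _ => zero_le)
    fun N => ?_
  have h3 := h x₀ (R N) (hR N) (Φ N) ((hΦ N).memLp 1).1
    (Eventually.of_forall fun x hx => (hΦ N).eq_zero hx)
  rwa [lintegral_differences_eq_one hp0 (hΦ1 N), mul_one] at h3

/-- Within distance $\delta$ of the diagonal the order-$t$ energy is at most $\delta^{(s-t)p}$ times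
the unit order-$s$ energy. Beyond it, the bound is $C_\delta\|\Phi_N\|_{L^p}^p$. First $\delta$ is
chosen small, then $N$ large. -/
theorem tendsto_gagliardoSeminorm_of_lt (hp : 1 < p) {t : ℝ} (ht : 0 < t)
    (hts : t < s) (hΦm : ∀ N, AEStronglyMeasurable (Φ N) volume)
    (hΦ1 : ∀ N, gagliardoSeminorm s p (Φ N) = 1)
    (hΦ0 : Tendsto (fun N => ∫⁻ x, ‖Φ N x‖ₑ ^ p) atTop (𝓝 0)) :
    Tendsto (fun N => gagliardoSeminorm t p (Φ N)) atTop (𝓝 0) := by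
  have hp0 : 0 < p := by linarith
  have hstp : 0 < (s - t) * p := mul_pos (by linarith) hp0
  have htp : 0 < t * p := mul_pos ht hp0
  have key : Tendsto (fun N => gagliardoSeminorm t p (Φ N) ^ p) atTop (𝓝 0) := by
    rw [ENNReal.tendsto_nhds_zero]
    intro ε hε
    have hδlim : Tendsto (fun δ : ℝ => ENNReal.ofReal (δ ^ ((s - t) * p))) (𝓝[>] 0) (𝓝 0) := by
      have h1 : Tendsto (fun δ : ℝ => δ ^ ((s - t) * p)) (𝓝 0) (𝓝 (0 ^ ((s - t) * p))) :=
        (Real.continuousAt_rpow_const 0 _ (Or.inr hstp.le)).tendsto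
      have h2 := (ENNReal.continuous_ofReal.tendsto _).comp h1
      rw [Real.zero_rpow hstp.ne', ENNReal.ofReal_zero] at h2
      exact h2.mono_left nhdsWithin_le_nhds
    obtain ⟨δ, hδε, hδ⟩ := ((ENNReal.tendsto_nhds_zero.1 hδlim (ε / 2)
      (ENNReal.half_pos hε.ne')).and eventually_mem_nhdsWithin).exists
    obtain ⟨C, hC, hfar⟩ := exists_lintegral_far_le (n := n) (p := p) (δ := δ) (r := n + t * p) hp
      hδ (by linarith)
    have hCΦ : Tendsto (fun N => C * ∫⁻ x, ‖Φ N x‖ₑ ^ p) atTop (𝓝 0) := by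
      simpa using ENNReal.Tendsto.const_mul hΦ0 (Or.inr hC)
    filter_upwards [ENNReal.tendsto_nhds_zero.1 hCΦ (ε / 2) (ENNReal.half_pos hε.ne')] with N hN
    have hS : MeasurableSet {z : EuclideanSpace ℝ (Fin n) × EuclideanSpace ℝ (Fin n) |
        δ ≤ ‖z.1 - z.2‖} := measurableSet_le measurable_const (by fun_prop)
    rw [gagliardoSeminorm_eq hp0, eLpNorm_ofReal_rpow hp0, ← lintegral_add_compl _ hS,
      ← ENNReal.add_halves ε]
    refine add_le_add ((hfar _ (hΦm N)).trans hN) ?_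
    have h3 := lintegral_near_le (n := n) (δ := δ) (r₁ := n + t * p) (r₂ := n + s * p) hδ
      (by positivity) (by nlinarith) (fun z => ‖differences (Φ N) z‖ₑ ^ p)
    rw [lintegral_differences_eq_one hp0 (hΦ1 N), mul_one] at h3
    refine h3.trans (le_trans (le_of_eq ?_) hδε)
    congr 2
    ring
  have h4 := key.ennrpow_const (1 / p)
  rw [ENNReal.zero_rpow_of_pos (by positivity)] at h4
  refine h4.congr fun N => ?_
  rw [← ENNReal.rpow_mul, mul_one_div_cancel hp0.ne', ENNReal.rpow_one]

end Concentration

/-! ### Comparison of the Dirichlet-to-Neumann pairing with $\sigma(x_0,x_0)$ -/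

section Limit

variable {s p l : ℝ} {σ : EuclideanSpace ℝ (Fin n) → EuclideanSpace ℝ (Fin n) → ℝ}

/-- The Dirichlet-to-Neumann pairing of an exterior value with itself is the minimal energy. -/
theorem IsWeakSolution.weightedPLaplacian_eq_energy (hn : 1 ≤ n) (hs₀ : 0 < s) (hs₁ : s < 1)
    (hp : 1 < p) (hσ : AEMeasurable (Function.uncurry σ)) (hl : 0 < l)
    (hlσ : ∀ x y, l ≤ σ x y ∧ σ x y ≤ l⁻¹) {Ω : Set (EuclideanSpace ℝ (Fin n))}
    {f u : EuclideanSpace ℝ (Fin n) → ℝ} (hf : MemSobolev s p f)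
    (hu : IsWeakSolution Ω s p σ f u) :
    weightedPLaplacian s p σ u f =
      ∫ z, |differences u z| ^ p ∂weightedMeasure (n + s * p) σ := by
  have hp0 : 0 < p := by linarith
  have hmem : ∀ w : EuclideanSpace ℝ (Fin n) → ℝ, MemSobolev s p w →
      MemLp (differences w) (ENNReal.ofReal p) (weightedMeasure (n + s * p) σ) := fun w hw =>
    (memLp_weightedMeasure_iff hl hlσ).2 ((memSobolev_iff hp0).1 hw).2
  -- The solution is tested with its own correction $u-f$.
  have h := hu.integral_eq_zero hn hs₀ hs₁ hp hσ hl hlσ hu.2.2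
  have h1 : ∀ z, signedPow p (differences u z) * differences (u - f) z =
      |differences u z| ^ p - signedPow p (differences u z) * differences f z := fun z => by
    rw [differences_sub, Pi.sub_apply, mul_sub, signedPow_mul_self hp]
  simp only [h1] at h
  rw [integral_sub (integrable_abs_rpow hp (hmem u hu.1))
    (integrable_signedPow_mul hp (hmem u hu.1) (hmem f hf))] at h
  rw [weightedPLaplacian_eq hσ hl fun x y => (hlσ x y).1]
  linarith

/-- Since $E_\sigma(u)=B_\sigma(u,f)\le(1-\frac1p)E_\sigma(u)+\frac1pE_\sigma(f)$, the first term
can be absorbed. -/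
theorem IsWeakSolution.energy_le (hn : 1 ≤ n) (hs₀ : 0 < s) (hs₁ : s < 1)
    (hp : 1 < p) (hσ : AEMeasurable (Function.uncurry σ)) (hl : 0 < l)
    (hlσ : ∀ x y, l ≤ σ x y ∧ σ x y ≤ l⁻¹) {Ω : Set (EuclideanSpace ℝ (Fin n))}
    {f u : EuclideanSpace ℝ (Fin n) → ℝ} (hf : MemSobolev s p f)
    (hu : IsWeakSolution Ω s p σ f u) :
    ∫ z, |differences u z| ^ p ∂weightedMeasure (n + s * p) σ ≤
      ∫ z, |differences f z| ^ p ∂weightedMeasure (n + s * p) σ := by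
  have hp0 : 0 < p := by linarith
  have hmem : ∀ w : EuclideanSpace ℝ (Fin n) → ℝ, MemSobolev s p w →
      MemLp (differences w) (ENNReal.ofReal p) (weightedMeasure (n + s * p) σ) := fun w hw =>
    (memLp_weightedMeasure_iff hl hlσ).2 ((memSobolev_iff hp0).1 hw).2
  have h1 := hu.weightedPLaplacian_eq_energy hn hs₀ hs₁ hp hσ hl hlσ hf
  rw [weightedPLaplacian_eq hσ hl fun x y => (hlσ x y).1] at h1
  have h2 := integral_signedPow_mul_le hp (hmem u hu.1) (hmem f hf)
  rw [h1] at h2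
  have h3 : 0 < 1 / p := by positivity
  exact le_of_mul_le_mul_left (by linarith) h3

/-- Near the diagonal, the solution and its exterior value have the same differences wherever those
of the exterior value do not vanish, if the latter is supported away from the domain. -/
theorem IsWeakSolution.ae_indicator_le (hs₀ : 0 < s) (hp : 1 < p)
    {Ω : Set (EuclideanSpace ℝ (Fin n))} (hΩ : IsOpen Ω) {x₀ : EuclideanSpace ℝ (Fin n)} {ρ : ℝ}
    (hρΩ : Disjoint (Metric.ball x₀ ρ) Ω) {f u : EuclideanSpace ℝ (Fin n) → ℝ}
    (hf : IsTestFunction (Metric.ball x₀ (ρ / 2)) f) (hu : IsWeakSolution Ω s p σ f u) :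
    ∀ᵐ z : EuclideanSpace ℝ (Fin n) × EuclideanSpace ℝ (Fin n),
      {z | ρ / 2 ≤ ‖z.1 - z.2‖}ᶜ.indicator (fun z => |differences f z| ^ p) z ≤
        |differences u z| ^ p := by
  have hp0 : 0 < p := by linarith
  filter_upwards [ae_prod_of_ae (hu.2.2.ae_eq_zero hs₀ hp0 hΩ)] with z ⟨h1, h2⟩
  rw [Set.indicator_apply]
  split_ifs with hz
  · have hz' : dist z.1 z.2 < ρ / 2 := by rw [dist_eq_norm]; exact not_le.1 hz
    -- If one point lies in the half ball, both lie in the full ball, where $u=f$ almost everywhere.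
    -- Otherwise `f` vanishes at both.
    by_cases h : z.1 ∈ Metric.ball x₀ (ρ / 2) ∨ z.2 ∈ Metric.ball x₀ (ρ / 2)
    · have hb : z.1 ∈ Metric.ball x₀ ρ ∧ z.2 ∈ Metric.ball x₀ ρ := by
        simp only [Metric.mem_ball] at h ⊢
        have t1 := dist_triangle z.1 z.2 x₀
        have t2 := dist_triangle_left z.2 x₀ z.1
        have t3 := dist_nonneg (x := z.1) (y := z.2)
        rcases h with h | h <;> constructor <;> linarith
      have e1 := h1 (Set.disjoint_left.1 hρΩ hb.1)
      have e2 := h2 (Set.disjoint_left.1 hρΩ hb.2)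
      rw [Pi.sub_apply, sub_eq_zero] at e1 e2
      rw [differences, differences, e1, e2]
    · rw [not_or] at h
      rw [differences, hf.eq_zero h.1, hf.eq_zero h.2, sub_zero, abs_zero, Real.zero_rpow hp0.ne']
      positivity
  · positivity

/-- With $T$ the far energy of $f$, two estimates combine:
$|E_\sigma(f)-\sigma(x_0,x_0)|\le\varepsilon+l^{-1}T$, because $f$ has unit energy, and
$E_\sigma(f)-l^{-1}T\le E_\sigma(u)\le E_\sigma(f)$. -/
theorem IsWeakSolution.abs_weightedPLaplacian_sub_le (hn : 1 ≤ n) (hs₀ : 0 < s) (hs₁ : s < 1)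
    (hp : 1 < p) (hσ : AEMeasurable (Function.uncurry σ)) (hl : 0 < l)
    (hlσ : ∀ x y, l ≤ σ x y ∧ σ x y ≤ l⁻¹) {Ω : Set (EuclideanSpace ℝ (Fin n))} (hΩ : IsOpen Ω)
    {x₀ : EuclideanSpace ℝ (Fin n)} {ρ ε : ℝ} (hρΩ : Disjoint (Metric.ball x₀ ρ) Ω)
    (hε : ∀ x ∈ Metric.ball x₀ ρ, ∀ y ∈ Metric.ball x₀ ρ, |σ x y - σ x₀ x₀| ≤ ε)
    {f u : EuclideanSpace ℝ (Fin n) → ℝ} (hf : IsTestFunction (Metric.ball x₀ (ρ / 2)) f)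
    (hf1 : gagliardoSeminorm s p f = 1) (hu : IsWeakSolution Ω s p σ f u) :
    |weightedPLaplacian s p σ u f - σ x₀ x₀| ≤ ε + 2 * (l⁻¹ *
      (∫⁻ z in {z | ρ / 2 ≤ ‖z.1 - z.2‖}, ‖differences f z‖ₑ ^ p
        ∂kernelMeasure n (n + s * p)).toReal) := by
  have hp0 : 0 < p := by linarith
  have hfS := hf.memSobolev hn hs₀ hs₁ hp
  set K := kernelMeasure n (n + s * p) with hK
  set W := weightedMeasure (n + s * p) σ with hW
  set S : Set (EuclideanSpace ℝ (Fin n) × EuclideanSpace ℝ (Fin n)) :=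
    {z | ρ / 2 ≤ ‖z.1 - z.2‖} with hSdef
  have hS : MeasurableSet S := measurableSet_le measurable_const (by fun_prop)
  set F := fun z => |differences f z| ^ p with hF
  have hF0 : ∀ z, 0 ≤ F z := fun z => by positivity
  have hFK : Integrable F K := integrable_abs_rpow hp ((memSobolev_iff hp0).1 hfS).2
  have hFW : Integrable F W := integrable_abs_rpow hp
    ((memLp_weightedMeasure_iff hl hlσ).2 ((memSobolev_iff hp0).1 hfS).2)
  have huW : Integrable (fun z => |differences u z| ^ p) W := integrable_abs_rpow hp
    ((memLp_weightedMeasure_iff hl hlσ).2 ((memSobolev_iff hp0).1 hu.1).2)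
  have hF1 : ∫ z, F z ∂K = 1 := by
    rw [integral_abs_rpow hp ((memSobolev_iff hp0).1 hfS).2, ← gagliardoSeminorm_eq hp0, hf1]
    simp
  have hT : (∫⁻ z in S, ‖differences f z‖ₑ ^ p ∂K).toReal = ∫ z, S.indicator F z ∂K := by
    rw [integral_indicator hS, integral_eq_lintegral_of_nonneg_ae
      (Eventually.of_forall hF0) hFK.1.restrict]
    simp only [hF, ofReal_abs_rpow hp0.le]
  rw [hT]
  set T := ∫ z, S.indicator F z ∂K
  have hSK : Integrable (S.indicator F) K := hFK.indicator hS
  have hσF : ∫ z, F z ∂W = ∫ z, σ z.1 z.2 * F z ∂K :=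
    integral_weightedMeasure hσ hl (fun x y => (hlσ x y).1) F
  have hσmul : ∀ g : EuclideanSpace ℝ (Fin n) × EuclideanSpace ℝ (Fin n) → ℝ, Integrable g K →
      Integrable (fun z => σ z.1 z.2 * g z) K := fun g hg =>
    hg.bdd_mul (c := l⁻¹) (aemeasurable_coefficient hσ).aestronglyMeasurable
      (Eventually.of_forall fun z => by
        rw [Real.norm_of_nonneg (hl.le.trans (hlσ _ _).1)]
        exact (hlσ _ _).2)
  have hconc : |∫ z, F z ∂W - σ x₀ x₀| ≤ ε + l⁻¹ * T := by
    have e1 : ∫ z, F z ∂W - σ x₀ x₀ = ∫ z, (σ z.1 z.2 - σ x₀ x₀) * F z ∂K := by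
      simp only [sub_mul]
      rw [integral_sub (hσmul F hFK) (hFK.const_mul _), integral_const_mul, hF1, mul_one, hσF]
    have e2 : ε + l⁻¹ * T = ∫ z, (ε * F z + l⁻¹ * S.indicator F z) ∂K := by
      rw [integral_add (hFK.const_mul _) (hSK.const_mul _), integral_const_mul,
        integral_const_mul, hF1, mul_one]
    rw [e1, e2, ← Real.norm_eq_abs]
    refine norm_integral_le_of_norm_le ((hFK.const_mul _).add (hSK.const_mul _))
      (Eventually.of_forall fun z => ?_)
    have hl0 : 0 < l⁻¹ := inv_pos.2 hl
    -- For `ρ ≤ 0` the balls are empty and `hε` says nothing about the sign of `ε`, but then `f`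
    -- vanishes identically.
    have hε0 : 0 ≤ ε ∨ F z = 0 := by
      by_cases h : 0 < ρ
      · exact Or.inl ((abs_nonneg _).trans
          (hε x₀ (Metric.mem_ball_self h) x₀ (Metric.mem_ball_self h)))
      · right
        have hz : ∀ x, f x = 0 := fun x => hf.eq_zero fun hx => by
          have := Metric.mem_ball.1 hx
          have := dist_nonneg (x := x) (y := x₀)
          linarith
        simp [hF, differences, hz, hp0.ne']
    rw [norm_mul, Real.norm_eq_abs, Real.norm_of_nonneg (hF0 z)]
    by_cases hz : z ∈ S
    · rw [Set.indicator_of_mem hz]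
      have hb : |σ z.1 z.2 - σ x₀ x₀| ≤ l⁻¹ := by
        rw [abs_le]
        constructor <;> linarith [hlσ z.1 z.2, hlσ x₀ x₀]
      have h1 := mul_le_mul_of_nonneg_right hb (hF0 z)
      rcases hε0 with h | h
      · have := mul_nonneg h (hF0 z)
        linarith
      · simp [h]
    · rw [Set.indicator_of_notMem hz, mul_zero, add_zero]
      have hz' : dist z.1 z.2 < ρ / 2 := by rw [dist_eq_norm]; exact not_le.1 hz
      by_cases h : z.1 ∈ Metric.ball x₀ (ρ / 2) ∨ z.2 ∈ Metric.ball x₀ (ρ / 2)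
      · have hb : z.1 ∈ Metric.ball x₀ ρ ∧ z.2 ∈ Metric.ball x₀ ρ := by
          simp only [Metric.mem_ball] at h ⊢
          have t1 := dist_triangle z.1 z.2 x₀
          have t2 := dist_triangle_left z.2 x₀ z.1
          have t3 := dist_nonneg (x := z.1) (y := z.2)
          rcases h with h | h <;> constructor <;> linarith
        exact mul_le_mul_of_nonneg_right (hε _ hb.1 _ hb.2) (hF0 z)
      · rw [not_or] at h
        have : F z = 0 := by
          simp [hF, differences, hf.eq_zero h.1, hf.eq_zero h.2, hp0.ne']
        simp [this]
  have hupper := hu.energy_le hn hs₀ hs₁ hp hσ hl hlσ hfS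
  have hlower : ∫ z, F z ∂W - l⁻¹ * T ≤ ∫ z, |differences u z| ^ p ∂W := by
    have e1 : ∫ z, S.indicator F z ∂W ≤ l⁻¹ * T := by
      rw [integral_weightedMeasure hσ hl fun x y => (hlσ x y).1, ← integral_const_mul]
      refine integral_mono (hσmul _ hSK) (hSK.const_mul _) fun z => ?_
      exact mul_le_mul_of_nonneg_right (hlσ _ _).2 (Set.indicator_nonneg (fun z _ => hF0 z) z)
    have e2 : ∫ z, Sᶜ.indicator F z ∂W ≤ ∫ z, |differences u z| ^ p ∂W :=
      integral_mono_ae (hFW.indicator hS.compl) huW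
        (weightedMeasure_absolutelyContinuous.ae_le (hu.ae_indicator_le hs₀ hp hΩ hρΩ hf))
    have e3 : ∫ z, F z ∂W = ∫ z, S.indicator F z ∂W + ∫ z, Sᶜ.indicator F z ∂W := by
      rw [integral_indicator hS, integral_indicator hS.compl, integral_add_compl hS hFW]
    linarith
  rw [hu.weightedPLaplacian_eq_energy hn hs₀ hs₁ hp hσ hl hlσ hfS]
  have hT0 : 0 ≤ l⁻¹ * T := mul_nonneg (inv_pos.2 hl).le
    (integral_nonneg fun z => Set.indicator_nonneg (fun z _ => hF0 z) z)
  rw [abs_le] at hconc ⊢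
  constructor <;> linarith

/-- The intermediate value is $\sigma(x,x_0)$: equicontinuity compares it with $\sigma(x,y)$
uniformly in $x$, and continuity of $\sigma(\cdot,x_0)$ compares it with $\sigma(x_0,x_0)$. -/
theorem exists_ball_abs_sub_le {W : Set (EuclideanSpace ℝ (Fin n))} (hW : IsOpen W)
    {x₀ : EuclideanSpace ℝ (Fin n)} (hx₀ : x₀ ∈ W) (h1 : EquicontinuousWithinAt σ W x₀)
    (h2 : ContinuousOn (fun x => σ x x₀) W) {ε : ℝ} (hε : 0 < ε) :
    ∃ ρ > 0, Metric.ball x₀ ρ ⊆ W ∧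
      ∀ x ∈ Metric.ball x₀ ρ, ∀ y ∈ Metric.ball x₀ ρ, |σ x y - σ x₀ x₀| ≤ ε := by
  have e1 := h1 _ (Metric.dist_mem_uniformity (half_pos hε))
  have e2 := (h2 x₀ hx₀).eventually (Metric.ball_mem_nhds _ (half_pos hε))
  rw [hW.nhdsWithin_eq hx₀] at e1 e2
  obtain ⟨ρ, hρ, h⟩ := Metric.eventually_nhds_iff_ball.1 ((e1.and e2).and (hW.mem_nhds hx₀))
  refine ⟨ρ, hρ, fun x hx => (h x hx).2, fun x hx y hy => ?_⟩
  have a1 : dist (σ x x₀) (σ x y) < ε / 2 := (h y hy).1.1 x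
  have a2 : dist (σ x x₀) (σ x₀ x₀) < ε / 2 := (h x hx).1.2
  rw [← Real.dist_eq]
  have := dist_triangle_left (σ x y) (σ x₀ x₀) (σ x x₀)
  linarith

end Limit

end

/-! ### Proof of the theorem -/

theorem theorem1p1 {n : ℕ} (hn : 1 ≤ n)
    (Ω W : Set (EuclideanSpace ℝ (Fin n)))
    (hΩ : IsOpen Ω) (hΩb : Bornology.IsBounded Ω)
    (hW : IsOpen W) (hWc : CompactlyContained W (exteriorDomain Ω))
    (s p : ℝ) (hs₀ : 0 < s) (hs₁ : s < 1) (hp : 1 < p)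
    (x₀ : EuclideanSpace ℝ (Fin n)) (hx₀ : x₀ ∈ W) :
    ∃ Φ : ℕ → EuclideanSpace ℝ (Fin n) → ℝ,
      (∀ N, IsTestFunction W (Φ N)) ∧
      (∀ N, gagliardoSeminorm s p (Φ N) = 1) ∧
      (∀ t : ℝ, 0 ≤ t → t < s → Tendsto (fun N => sobolevNorm t p (Φ N)) atTop (𝓝 0)) ∧
      Tendsto (fun N => tsupport (Φ N)) atTop (𝓝 x₀).smallSets ∧
      ∀ σ : EuclideanSpace ℝ (Fin n) → EuclideanSpace ℝ (Fin n) → ℝ,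
        AEMeasurable (Function.uncurry σ) →
        UniformlyElliptic σ →
        EquicontinuousWithinAt σ W x₀ →
        ContinuousOn (fun x => σ x x₀) W →
        -- the exterior value problem is uniquely solvable, so that the DN map is meaningful
        (∀ f, MemSobolev s p f → ∃ u, IsWeakSolution Ω s p σ f u ∧
          ∀ v, IsWeakSolution Ω s p σ f v → v =ᵐ[volume] u) ∧
        Tendsto (fun N => dnMap Ω s p σ (Φ N) (Φ N)) atTop (𝓝 (σ x₀ x₀)) := by
  have hp0 : 0 < p := by linarith
  have hsp : 0 < s * p := mul_pos hs₀ hp0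
  obtain ⟨ρ₀, hρ₀, hρW⟩ := Metric.isOpen_iff.1 hW x₀ hx₀
  -- The radii shrink to zero and keep every ball inside `W`. They do not depend on `σ`, so one
  -- sequence serves all coefficients.
  set R : ℕ → ℝ := fun N => ρ₀ / (N + 1) with hRdef
  have hR : ∀ N, 0 < R N := fun N => by positivity
  have hRle : ∀ N, R N ≤ ρ₀ := fun N => div_le_self hρ₀.le (by simp)
  have hR0 : Tendsto R atTop (𝓝 0) := by
    simpa [hRdef, div_eq_mul_one_div ρ₀] using
      (tendsto_one_div_add_atTop_nhds_zero_nat (𝕜 := ℝ)).const_mul ρ₀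
  choose Φ hΦ hΦ1 using fun N =>
    exists_isTestFunction_gagliardoSeminorm_eq_one hn hs₀ hs₁ hp x₀ (hR N)
  have hΦ0 := tendsto_lintegral_of_concentrating hn hs₀ hp hR hR0 hΦ hΦ1
  have hΦL : Tendsto (fun N => eLpNorm (Φ N) (ENNReal.ofReal p) volume) atTop (𝓝 0) := by
    have h := hΦ0.ennrpow_const (1 / p)
    rw [ENNReal.zero_rpow_of_pos (by positivity)] at h
    refine h.congr fun N => ?_
    rw [← eLpNorm_ofReal_rpow hp0, ← ENNReal.rpow_mul, mul_one_div_cancel hp0.ne',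
      ENNReal.rpow_one]
  have hsupp : ∀ ρ > 0, ∀ᶠ N in atTop, IsTestFunction (Metric.ball x₀ ρ) (Φ N) := fun ρ hρ => by
    filter_upwards [hR0.eventually_lt_const hρ] with N hN
    exact (hΦ N).mono (Metric.ball_subset_ball hN.le)
  refine ⟨Φ, fun N => (hΦ N).mono ((Metric.ball_subset_ball (hRle N)).trans hρW), hΦ1, ?_, ?_, ?_⟩
  · intro t ht hts
    rcases ht.eq_or_lt with rfl | ht
    · simpa [sobolevNorm] using hΦL
    · exact tendsto_sobolevNorm ht hp0 hΦL (tendsto_gagliardoSeminorm_of_lt hp ht hts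
        (fun N => ((hΦ N).memLp 1).1) hΦ1 hΦ0)
  · rw [tendsto_smallSets_iff]
    intro U hU
    obtain ⟨ρ, hρ, hρU⟩ := Metric.mem_nhds_iff.1 hU
    filter_upwards [hsupp ρ hρ] with N hN using hN.2.2.trans hρU
  · rintro σ hσ ⟨l, hl, hlσ⟩ heq hcont
    refine ⟨fun f hf => ?_, ?_⟩
    · obtain ⟨u, hu⟩ := exists_isWeakSolution hn hs₀ hs₁ hp hσ hl hlσ hΩb hf
      exact ⟨u, hu, fun v hv => hv.ae_eq hn hs₀ hs₁ hp hσ hl hlσ hΩ hΩb hu⟩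
    · rw [Metric.tendsto_nhds]
      intro ε hε
      -- Half of `ε` pays for the oscillation of `σ` near $(x_0,x_0)$, the other half for the far
      -- energy.
      obtain ⟨ρ, hρ, hρW', hρσ⟩ := exists_ball_abs_sub_le hW hx₀ heq hcont (half_pos hε)
      have hdisj : Disjoint (Metric.ball x₀ ρ) Ω := Set.disjoint_left.2 fun x hx hxΩ =>
        hWc.2 (subset_closure (hρW' hx)) (subset_closure hxΩ)
      obtain ⟨C, hC, hfar⟩ := exists_lintegral_far_le (n := n) (p := p) (δ := ρ / 2)
        (r := n + s * p) hp (half_pos hρ) (by linarith)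
      have hT : Tendsto (fun N => (∫⁻ z in {z | ρ / 2 ≤ ‖z.1 - z.2‖},
          ‖differences (Φ N) z‖ₑ ^ p ∂kernelMeasure n (n + s * p))) atTop (𝓝 0) := by
        have hCΦ : Tendsto (fun N => C * ∫⁻ x, ‖Φ N x‖ₑ ^ p) atTop (𝓝 0) := by
          simpa using ENNReal.Tendsto.const_mul hΦ0 (Or.inr hC)
        exact tendsto_of_tendsto_of_tendsto_of_le_of_le tendsto_const_nhds hCΦ
          (fun _ => zero_le) fun N => hfar _ ((hΦ N).memLp 1).1
      have hT' := ((((ENNReal.tendsto_toReal ENNReal.zero_ne_top).comp hT).const_mul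
        l⁻¹).const_mul 2).const_add (ε / 2)
      rw [ENNReal.toReal_zero, mul_zero, mul_zero, add_zero] at hT'
      filter_upwards [hsupp (ρ / 2) (half_pos hρ), hT'.eventually_lt_const (half_lt_self hε)]
        with N hN hTN
      -- Existence guarantees that the chosen representative really is a solution.
      have hu : IsWeakSolution Ω s p σ (Φ N) (weakSolution Ω s p σ (Φ N)) :=
        Classical.epsilon_spec (exists_isWeakSolution hn hs₀ hs₁ hp hσ hl hlσ hΩb
          (hN.memSobolev hn hs₀ hs₁ hp))
      rw [Real.dist_eq, dnMap]
      exact (hu.abs_weightedPLaplacian_sub_le hn hs₀ hs₁ hp hσ hl hlσ hΩ hdisj hρσ hN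
        (hΦ1 N)).trans_lt hTN
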